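/- Let $d\ge 1$, and let $\mathbb S^d\subset\mathbb R^{d+1}$ be the Euclidean unit sphere with its normalized surface Lebesgue measure $\mu_d$. Let $r\ge 0$ and $\ell\ge 1$ be integers and let $\Phi:[-1,1]\to\mathbb R$ be a piecewise polynomial of degree at most $r$ with knots $-1=s_0<s_1<\cdots<s_\ell=1$ (that is, on each $[s_{j-1},s_j]$, $1\le j\le \ell$, $\Phi$ coincides with a real polynomial of degree at most $r$) such that $|\Phi(s)-\Phi(s')|\le|s-s'|$ for all $s,s'\in[-1,1]$. Let $m_r=m_r^d$ denote the dimension of the space of all spherical polynomials of degree at most $r$ on $\mathbb S^d$, i.e. of the restrictions to $\mathbb S^d$ of real polynomials in $d+1$ variables of total degree at most $r$. Let $g\in L^\infty(\mathbb S^d,\mu_d)$ be real-valued with $\|g\|_\infty\le 1$. Then for each integer $N\ge 20$ there exist (not necessarily distinct) points $\xi_1,\dots,\xi_{2(m_r+2)N}\in\mathbb S^d$ and real numbers $\lambda_1,\dots,\lambda_{2(m_r+2)N}$ such that $$\max_{x\in\mathbb S^d}\left|\int_{\mathbb S^d}\Phi(x\cdot y)\,g(y)\,d\mu_d(y)-\sum_{j=1}^{2(m_r+2)N}\lambda_j\,\Phi(x\cdot\xi_j)\right|\le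 7\cdot 10^6\,\sqrt{\ell}\;d^{3/4}\,N^{-\frac12-\frac{3}{2d}}\sqrt{\log N}.$$ -/

import Mathlib

open MeasureTheory

noncomputable section

/-- The unit sphere `𝕊^d` of the Euclidean space `ℝ^(d+1)`. -/
abbrev UnitSphere (d : ℕ) : Type :=
  Metric.sphere (0 : EuclideanSpace ℝ (Fin (d + 1))) 1

/-- The normalized surface Lebesgue measure `μ_d` on `𝕊^d`: the surface measure divided by
its total mass. -/
def sphereMeasure (d : ℕ) : Measure (UnitSphere d) :=
  ((volume : Measure (EuclideanSpace ℝ (Fin (d + 1)))).toSphere Set.univ)⁻¹ •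
    (volume : Measure (EuclideanSpace ℝ (Fin (d + 1)))).toSphere

/-- Restriction of a real polynomial in `d + 1` variables to a function on `𝕊^d`. -/
def restrictToSphere (d : ℕ) : MvPolynomial (Fin (d + 1)) ℝ →ₗ[ℝ] (UnitSphere d → ℝ) where
  toFun p := fun x => MvPolynomial.eval (fun i => (x : EuclideanSpace ℝ (Fin (d + 1))) i) p
  map_add' p q := by funext x; simp
  map_smul' c p := by funext x; simp [MvPolynomial.smul_eval]

/-- The space of spherical polynomials of degree at most `r` on `𝕊^d`: the restrictions to
`𝕊^d` of the real polynomials in `d + 1` variables of total degree at most `r`. -/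
def sphericalPolynomials (d r : ℕ) : Submodule ℝ (UnitSphere d → ℝ) :=
  (MvPolynomial.restrictTotalDegree (Fin (d + 1)) ℝ r).map (restrictToSphere d)

/-- The dimension `m_r = m_r^d` of the space of spherical polynomials of degree at most `r`. -/
def sphericalDim (d r : ℕ) : ℕ :=
  Module.finrank ℝ (sphericalPolynomials d r)

/-- `Φ` is, on `[-1, 1]`, a piecewise polynomial of degree at most `r` with knots
`-1 = s 0 < s 1 < ⋯ < s ℓ = 1`. -/
structure IsPiecewisePolynomial (r ℓ : ℕ) (s : Fin (ℓ + 1) → ℝ) (Φ : ℝ → ℝ) : Prop where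
  strictMono : StrictMono s
  first : s 0 = -1
  last : s (Fin.last ℓ) = 1
  eq_poly : ∀ j : Fin ℓ, ∃ p : Polynomial ℝ, p.natDegree ≤ r ∧
    ∀ t ∈ Set.Icc (s j.castSucc) (s j.succ), Φ t = p.eval t

end

/-! The argument is stratified random sampling with polynomial-exact samples, derandomized. The
integral is first replaced by a signed discrete measure `ν` on a net of mesh `N⁻²`. The net points
are grouped into at most `N / 2` cells of radius `δ = 32 N^(-1/d)`. In a cell, `|ν|` is a convex
combination of nonnegative vectors with at most `m_r + 1` atoms having the same total mass and,
after reinserting the signs of `ν`, the same integrals of all spherical polynomials of degree at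
most `r` (`mem_convexHull_sparseRepresentatives`). Sampling one such vector is unbiased.

A cell of mass `ω` receives about `ω N / 2` samples, so there are at most `N` samples in total. For
fixed `x`, a sample has zero error unless its cell has points on both sides of a parallel `⟪x, ·⟫ =
s j`: otherwise `Φ(⟪x, ·⟫)` is one polynomial on the cell. In a crossed cell the Lipschitz bound
gives an error of order `δ / N`. Crossed cells lie in `ℓ + 1` bands of angular width of order `δ`,
hence of measure of order `δ √d` each (`sphereMeasure_band_le`), so the sum of squared errors is of
order `ℓ √d δ³ / N`. A Hoeffding bound over the net points `x` costs a factor `d log N` and gives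
the rate `√ℓ d^(3/4) N^(-1/2 - 3/(2d)) √(log N)` (`exists_rounding`). Passing from net points to all
`x` costs only a multiple of `N⁻²`.

The random choice is realized by conditional expectations: samples are fixed one at a time without
increasing an exponential potential (`exists_choice_abs_sum_le`). -/

/-! ### Sparse decompositions with prescribed moments -/

/-- Nonnegative vectors supported in the support of `a`, with at most `finrank W` nonzero entries
and with the same moments as `a` against `W`. -/
def sparseRepresentatives {Q : Type*} [Fintype Q] (W : Submodule ℝ (Q → ℝ)) (a : Q → ℝ) :
    Set (Q → ℝ) :=
  {b | (∀ q, 0 ≤ b q) ∧ (∀ q, a q = 0 → b q = 0) ∧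
    (Function.support b).ncard ≤ Module.finrank ℝ W ∧ ∀ w ∈ W, ∑ q, b q * w q = ∑ q, a q * w q}

/-- Ratio test of linear programming: move from `a` along `v` until the first coordinate reaches
zero. -/
theorem exists_pos_add_smul_nonneg_support_ssubset {Q : Type*} [Fintype Q] {a v : Q → ℝ}
    (ha : ∀ q, 0 ≤ a q) (hv : ∀ q, a q = 0 → v q = 0) (hneg : ∃ q, v q < 0) :
    ∃ t : ℝ, 0 < t ∧ (∀ q, 0 ≤ (a + t • v) q) ∧
      Function.support (a + t • v) ⊂ Function.support a := by
  classical
  obtain ⟨q₀, hq₀⟩ := hneg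
  let F : Finset Q := Finset.univ.filter fun q => v q < 0
  have hF : F.Nonempty := ⟨q₀, by simp [F, hq₀]⟩
  obtain ⟨q₁, hq₁F, hq₁⟩ := F.exists_min_image (fun q => a q / -v q) hF
  have hv₁ : v q₁ < 0 := by simpa [F] using hq₁F
  have ha₁ : 0 < a q₁ := lt_of_le_of_ne (ha q₁) fun h => by
    have := hv q₁ h.symm
    linarith
  refine ⟨a q₁ / -v q₁, div_pos ha₁ (by linarith), fun q => ?_, ?_⟩
  · simp only [Pi.add_apply, Pi.smul_apply, smul_eq_mul]
    by_cases hq : v q < 0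
    · have h := hq₁ q (by simp [F, hq])
      rw [le_div_iff₀ (by linarith)] at h
      linarith
    · have : 0 ≤ a q₁ / -v q₁ := (div_pos ha₁ (by linarith)).le
      have := mul_nonneg this (not_lt.1 hq)
      linarith [ha q]
  · rw [Set.ssubset_iff_of_subset]
    · refine ⟨q₁, by simpa using ha₁.ne', ?_⟩
      simp only [Function.mem_support, Pi.add_apply, Pi.smul_apply, smul_eq_mul, not_not]
      field_simp [hv₁.ne]
      ring
    · intro q hq h
      exact hq (by simp [h, hv q h])

/-- Dimension count: the pairing maps `s → ℝ` to the dual of `W`, which has smaller dimension. -/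
theorem exists_ne_zero_orthogonal_of_finrank_lt {Q : Type*} [Fintype Q] (W : Submodule ℝ (Q → ℝ))
    (s : Set Q) (hs : Module.finrank ℝ W < s.ncard) :
    ∃ v : Q → ℝ, v ≠ 0 ∧ (∀ q, q ∉ s → v q = 0) ∧ ∀ w ∈ W, ∑ q, v q * w q = 0 := by
  classical
  let L : (s → ℝ) →ₗ[ℝ] Module.Dual ℝ W :=
    LinearMap.mk₂ ℝ (fun (u : s → ℝ) (w : W) => ∑ q, u q * (w : Q → ℝ) q)
      (fun u u' w => by simp [add_mul, Finset.sum_add_distrib])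
      (fun c u w => by simp [Finset.mul_sum, mul_assoc])
      (fun u w w' => by simp [mul_add, Finset.sum_add_distrib])
      (fun c u w => by simp [Finset.mul_sum, mul_left_comm])
  have hL : LinearMap.ker L ≠ ⊥ := LinearMap.ker_ne_bot_of_finrank_lt (by
    rw [Subspace.dual_finrank_eq, Module.finrank_fintype_fun_eq_card, ← Nat.card_eq_fintype_card,
      Nat.card_coe_set_eq]
    exact hs)
  obtain ⟨u, hu, hu0⟩ := (Submodule.ne_bot_iff _).1 hL
  refine ⟨fun q => if h : q ∈ s then u ⟨q, h⟩ else 0, ?_, ?_, ?_⟩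
  · intro h
    apply hu0
    ext q
    have := congrFun h q
    simpa using this
  · intro q hq
    simp [hq]
  · intro w hw
    have h1 : ∑ q : s, u q * w q = 0 := by
      have := LinearMap.congr_fun (LinearMap.mem_ker.1 hu) ⟨w, hw⟩
      simpa [L] using this
    refine Eq.trans ?_ h1
    rw [← Finset.sum_subset (Finset.subset_univ s.toFinset)]
    · rw [← Finset.sum_coe_sort]
      refine Fintype.sum_equiv (Equiv.subtypeEquivRight (by simp)) _ _ ?_
      rintro ⟨q, hq⟩
      have hq' : q ∈ s := by simpa using hq
      simp only [dif_pos hq']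
      rfl
    · intro q _ hq
      have hq' : q ∉ s := by simpa using hq
      simp only [dif_neg hq', zero_mul]

/-- Carathéodory-type reduction, by induction on the size of the support. If the support is too
large, it carries a nonzero `v` orthogonal to `W`. Since `1 ∈ W`, the entries of `v` sum to zero, so
both signs occur and one can move from `a` along `v` and along `-v` until the support shrinks. The
moments do not change, and `a` lies between the two endpoints. -/
theorem mem_convexHull_sparseRepresentatives {Q : Type*} [Fintype Q] (W : Submodule ℝ (Q → ℝ))
    (hW : (1 : Q → ℝ) ∈ W) (a : Q → ℝ) (ha : ∀ q, 0 ≤ a q) :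
    a ∈ convexHull ℝ (sparseRepresentatives W a) := by
  induction hn : (Function.support a).ncard using Nat.strong_induction_on generalizing a with
  | _ n ih =>
  subst hn
  by_cases hc : (Function.support a).ncard ≤ Module.finrank ℝ W
  · exact subset_convexHull _ _ ⟨ha, fun _ h => h, hc, fun _ _ => rfl⟩
  obtain ⟨v, hv0, hvs, hvW⟩ := exists_ne_zero_orthogonal_of_finrank_lt W _ (not_le.1 hc)
  have hvs' : ∀ q, a q = 0 → v q = 0 := fun q hq => hvs q (by simpa using hq)
  have hsum : ∑ q, v q = 0 := by simpa using hvW 1 hW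
  have key : ∀ u : Q → ℝ, (∀ q, a q = 0 → u q = 0) → (∀ w ∈ W, ∑ q, u q * w q = 0) →
      (∃ q, u q < 0) →
      ∃ t : ℝ, 0 < t ∧ a + t • u ∈ convexHull ℝ (sparseRepresentatives W a) := by
    intro u hu huW hneg
    obtain ⟨t, ht, hnn, hss⟩ := exists_pos_add_smul_nonneg_support_ssubset ha hu hneg
    refine ⟨t, ht, convexHull_mono ?_ (ih _ (Set.ncard_lt_ncard hss (Set.toFinite _)) _ hnn rfl)⟩
    rintro b ⟨hb, hb0, hbc, hbW⟩
    refine ⟨hb, fun q hq => hb0 q (by simp [hq, hu q hq]), hbc, fun w hw => ?_⟩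
    rw [hbW w hw]
    simp only [Pi.add_apply, Pi.smul_apply, smul_eq_mul, add_mul, Finset.sum_add_distrib,
      mul_assoc, ← Finset.mul_sum, huW w hw, mul_zero, add_zero]
  have hneg : ∃ q, v q < 0 := by
    by_contra! h
    exact hv0 (funext fun q => (Finset.sum_eq_zero_iff_of_nonneg fun q _ => h q).1 hsum q
      (Finset.mem_univ q))
  have hpos : ∃ q, (-v) q < 0 := by
    by_contra! h
    refine hv0 (funext fun q => ?_)
    have := (Finset.sum_eq_zero_iff_of_nonneg fun q _ => h q).1
      (by simpa using hsum) q (Finset.mem_univ q)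
    simpa using this
  obtain ⟨t₁, ht₁, h₁⟩ := key v hvs' hvW hneg
  obtain ⟨t₂, ht₂, h₂⟩ := key (-v) (fun q hq => by simp [hvs' q hq])
    (fun w hw => by simpa using hvW w hw) hpos
  have hconv := convex_convexHull ℝ (sparseRepresentatives W a) h₁ h₂
    (a := t₂ / (t₁ + t₂)) (b := t₁ / (t₁ + t₂)) (by positivity) (by positivity) (by field_simp; ring)
  convert hconv using 1
  ext q
  simp only [Pi.add_apply, Pi.smul_apply, Pi.neg_apply, smul_eq_mul]
  field_simp
  ring

/-! ### Simultaneous rounding -/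

/-- The chord of the convex exponential over `[-c, c]`. Being affine in `x`, it can be averaged over
a convex combination. -/
theorem Real.exp_mul_le_cosh_add {c x : ℝ} (hx : |x| ≤ c) (t : ℝ) :
    Real.exp (t * x) ≤ Real.cosh (t * c) + x / c * Real.sinh (t * c) := by
  rcases (abs_nonneg x |>.trans hx).eq_or_lt with h0 | hc
  · subst h0
    have : x = 0 := by simpa using hx
    simp [this]
  obtain ⟨h1, h2⟩ := abs_le.1 hx
  have hconv := convexOn_exp.2 (Set.mem_univ (t * c)) (Set.mem_univ (-(t * c)))
    (show 0 ≤ (c + x) / (2 * c) from div_nonneg (by linarith) (by linarith))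
    (show 0 ≤ (c - x) / (2 * c) from div_nonneg (by linarith) (by linarith))
    (by field_simp; ring)
  have he : ((c + x) / (2 * c)) • (t * c) + ((c - x) / (2 * c)) • -(t * c) = t * x := by
    simp only [smul_eq_mul]
    field_simp
    ring
  rw [he] at hconv
  refine hconv.trans (le_of_eq ?_)
  rw [Real.cosh_eq, Real.sinh_eq]
  simp only [smul_eq_mul]
  field_simp
  ring

/-- One step of the conditional expectation method. After the chord bound the potential is affine in
`v`, so some `v ∈ S` does no worse than the mean `0`, where `cosh y ≤ exp (y² / 2)` applies. -/
theorem exists_mem_sum_exp_le {X : Type*} [Fintype X] {S : Set (X → ℝ)}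
    (h0 : (0 : X → ℝ) ∈ convexHull ℝ S) {c : X → ℝ} (hc : ∀ v ∈ S, ∀ x, |v x| ≤ c x)
    (t : ℝ) (A B : X → ℝ) (hA : ∀ x, 0 ≤ A x) (hB : ∀ x, 0 ≤ B x) :
    ∃ v ∈ S, ∑ x, (A x * Real.exp (t * v x) + B x * Real.exp (-t * v x)) ≤
      ∑ x, (A x + B x) * Real.exp ((t * c x) ^ 2 / 2) := by
  let f : (X → ℝ) → ℝ := fun v => ∑ x, (A x * (Real.cosh (t * c x) + v x / c x * Real.sinh (t * c x))
    + B x * (Real.cosh (-t * c x) + v x / c x * Real.sinh (-t * c x)))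
  have hf : ConcaveOn ℝ Set.univ f := by
    refine ⟨convex_univ, fun u _ v _ a b _ _ hab => le_of_eq ?_⟩
    simp only [f, smul_eq_mul, Finset.mul_sum, ← Finset.sum_add_distrib, Pi.add_apply,
      Pi.smul_apply]
    refine Finset.sum_congr rfl fun x _ => ?_
    obtain rfl : a = 1 - b := by linarith
    ring
  obtain ⟨v, hv, hvf⟩ := hf.exists_le_of_mem_convexHull (Set.subset_univ S) h0
  refine ⟨v, hv, ?_⟩
  calc _ ≤ f v := by
        refine Finset.sum_le_sum fun x _ => add_le_add ?_ ?_
        · exact mul_le_mul_of_nonneg_left (Real.exp_mul_le_cosh_add (hc v hv x) t) (hA x)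
        · exact mul_le_mul_of_nonneg_left (Real.exp_mul_le_cosh_add (hc v hv x) (-t)) (hB x)
    _ ≤ f 0 := hvf
    _ = ∑ x, (A x + B x) * Real.cosh (t * c x) := by
        refine Finset.sum_congr rfl fun x _ => ?_
        simp [neg_mul, Real.cosh_neg, add_mul]
    _ ≤ _ := Finset.sum_le_sum fun x _ => mul_le_mul_of_nonneg_left
        (Real.cosh_le_exp_half_sq _) (add_nonneg (hA x) (hB x))

/-- The weights `A` and `B` make the induction close: they absorb the exponential factors of choices
already made and the bounds for choices still to come. -/
theorem exists_choice_sum_exp_le {ι X : Type*} [Fintype X] (P : Finset ι)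
    (S : ι → Set (X → ℝ)) (c : ι → X → ℝ) (h0 : ∀ p ∈ P, (0 : X → ℝ) ∈ convexHull ℝ (S p))
    (hc : ∀ p ∈ P, ∀ v ∈ S p, ∀ x, |v x| ≤ c p x) (t : ℝ) :
    ∀ A B : X → ℝ, (∀ x, 0 ≤ A x) → (∀ x, 0 ≤ B x) →
    ∃ v : ι → X → ℝ, (∀ p ∈ P, v p ∈ S p) ∧
      ∑ x, (A x * Real.exp (t * ∑ p ∈ P, v p x) + B x * Real.exp (-t * ∑ p ∈ P, v p x)) ≤
      ∑ x, (A x + B x) * Real.exp (∑ p ∈ P, (t * c p x) ^ 2 / 2) := by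
  classical
  induction P using Finset.induction_on with
  | empty => exact fun A B _ _ => ⟨0, by simp, by simp⟩
  | insert p P hp ih =>
    intro A B hA hB
    obtain ⟨u, hu, hule⟩ := exists_mem_sum_exp_le (h0 p (Finset.mem_insert_self _ _))
      (hc p (Finset.mem_insert_self _ _)) t
      (fun x => A x * Real.exp (∑ p ∈ P, (t * c p x) ^ 2 / 2))
      (fun x => B x * Real.exp (∑ p ∈ P, (t * c p x) ^ 2 / 2))
      (fun x => mul_nonneg (hA x) (Real.exp_nonneg _))
      (fun x => mul_nonneg (hB x) (Real.exp_nonneg _))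
    obtain ⟨v, hv, hvle⟩ := ih (fun q hq => h0 q (Finset.mem_insert_of_mem hq))
      (fun q hq => hc q (Finset.mem_insert_of_mem hq))
      (fun x => A x * Real.exp (t * u x)) (fun x => B x * Real.exp (-t * u x))
      (fun x => mul_nonneg (hA x) (Real.exp_nonneg _))
      (fun x => mul_nonneg (hB x) (Real.exp_nonneg _))
    have hvu : ∀ q ∈ P, Function.update v p u q = v q := fun q hq =>
      Function.update_of_ne (by rintro rfl; exact hp hq) _ _
    refine ⟨Function.update v p u, ?_, ?_⟩
    · intro q hq
      rcases Finset.mem_insert.1 hq with rfl | hq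
      · simpa using hu
      · rw [hvu q hq]
        exact hv q hq
    · have hs : ∀ x, ∑ q ∈ insert p P, Function.update v p u q x = u x + ∑ q ∈ P, v q x := by
        intro x
        rw [Finset.sum_insert hp, Function.update_self]
        congr 1
        exact Finset.sum_congr rfl fun q hq => by rw [hvu q hq]
      calc _ = ∑ x, (A x * Real.exp (t * u x) * Real.exp (t * ∑ p ∈ P, v p x) +
              B x * Real.exp (-t * u x) * Real.exp (-t * ∑ p ∈ P, v p x)) := by
            refine Finset.sum_congr rfl fun x _ => ?_
            rw [hs, mul_add, mul_add, Real.exp_add, Real.exp_add]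
            ring
        _ ≤ _ := hvle
        _ = _ := Finset.sum_congr rfl fun x _ => by ring
        _ ≤ _ := hule
        _ = _ := Finset.sum_congr rfl fun x _ => by
            rw [Finset.sum_insert hp, Real.exp_add]
            ring

theorem exists_choice_abs_sum_le {ι X : Type*} [Fintype X] (P : Finset ι)
    (S : ι → Set (X → ℝ)) (c : ι → X → ℝ) (h0 : ∀ p ∈ P, (0 : X → ℝ) ∈ convexHull ℝ (S p))
    (hc : ∀ p ∈ P, ∀ v ∈ S p, ∀ x, |v x| ≤ c p x) {V K : ℝ} (hV : 0 < V)
    (hcV : ∀ x, ∑ p ∈ P, c p x ^ 2 ≤ V) (hK : 0 < K)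
    (hX : 2 * (Fintype.card X : ℝ) ≤ Real.exp K) :
    ∃ v : ι → X → ℝ, (∀ p ∈ P, v p ∈ S p) ∧ ∀ x, |∑ p ∈ P, v p x| ≤ Real.sqrt (2 * V * K) := by
  -- With this `t`, the exponent `t² V / 2` equals `K`, and the final bound `2K / t` equals
  -- `√(2VK)`.
  set t : ℝ := Real.sqrt (2 * K / V) with ht
  have htpos : 0 < t := Real.sqrt_pos.2 (by positivity)
  have ht2 : t ^ 2 = 2 * K / V := Real.sq_sqrt (by positivity)
  obtain ⟨v, hv, hle⟩ := exists_choice_sum_exp_le P S c h0 hc t 1 1 (by simp) (by simp)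
  refine ⟨v, hv, fun x => ?_⟩
  have hbound : ∑ x, ((1 : X → ℝ) x * Real.exp (t * ∑ p ∈ P, v p x) +
      (1 : X → ℝ) x * Real.exp (-t * ∑ p ∈ P, v p x)) ≤ Real.exp (2 * K) := by
    refine hle.trans ?_
    calc _ ≤ ∑ x : X, 2 * Real.exp K := by
          refine Finset.sum_le_sum fun x _ => ?_
          have : ∑ p ∈ P, (t * c p x) ^ 2 / 2 ≤ K := by
            calc _ = t ^ 2 / 2 * ∑ p ∈ P, c p x ^ 2 := by
                  rw [Finset.mul_sum]
                  exact Finset.sum_congr rfl fun p _ => by ring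
              _ ≤ t ^ 2 / 2 * V := by gcongr; exact hcV x
              _ = K := by rw [ht2]; field_simp
          have h2 : (1 : X → ℝ) x + (1 : X → ℝ) x = 2 := by norm_num
          rw [h2]
          gcongr
      _ = 2 * (Fintype.card X : ℝ) * Real.exp K := by
          simp
          ring
      _ ≤ Real.exp K * Real.exp K := by gcongr
      _ = _ := by rw [← Real.exp_add]; ring_nf
  have hx : Real.exp (t * |∑ p ∈ P, v p x|) ≤ Real.exp (2 * K) := by
    refine le_trans ?_ hbound
    refine le_trans ?_ (Finset.single_le_sum (fun x _ => by
      simp only [Pi.one_apply]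
      positivity) (Finset.mem_univ x))
    simp only [Pi.one_apply, one_mul]
    rcases abs_cases (∑ p ∈ P, v p x) with ⟨h, _⟩ | ⟨h, _⟩
    · rw [h]
      exact le_add_of_nonneg_right (Real.exp_nonneg _)
    · rw [h, mul_neg, ← neg_mul]
      exact le_add_of_nonneg_left (Real.exp_nonneg _)
  rw [Real.exp_le_exp] at hx
  rw [← mul_le_mul_iff_right₀ htpos]
  refine hx.trans (le_of_eq ?_)
  rw [ht, ← Real.sqrt_mul (by positivity), show 2 * K / V * (2 * V * K) = (2 * K) ^ 2 by
    field_simp, Real.sqrt_sq (by positivity)]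

/-! ### The measure of a band on the sphere -/

theorem lintegral_fun_norm_eq_toSphere_mul {E : Type*} [NormedAddCommGroup E] [NormedSpace ℝ E]
    [MeasurableSpace E] [BorelSpace E] [FiniteDimensional ℝ E] [Nontrivial E]
    (μ : Measure E) [μ.IsAddHaarMeasure] {f : ℝ → ENNReal} (hf : Measurable f) :
    ∫⁻ x, f ‖x‖ ∂μ = μ.toSphere Set.univ *
      ∫⁻ r in Set.Ioi (0 : ℝ), ENNReal.ofReal (r ^ (Module.finrank ℝ E - 1)) * f r := by
  calc
    ∫⁻ x, f ‖x‖ ∂μ = ∫⁻ x : ({(0)}ᶜ : Set E), f ‖x.1‖ ∂(μ.comap (↑)) := by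
      rw [lintegral_subtype_comap (measurableSet_singleton _).compl fun x => f ‖x‖,
        restrict_compl_singleton]
    _ = ∫⁻ x, f x.2 ∂μ.toSphere.prod (Measure.volumeIoiPow (Module.finrank ℝ E - 1)) := by
      simpa using μ.measurePreserving_homeomorphUnitSphereProd.lintegral_comp_emb
        (Homeomorph.measurableEmbedding _) (f ∘ Subtype.val ∘ Prod.snd)
    _ = μ.toSphere Set.univ *
        ∫⁻ r : Set.Ioi (0 : ℝ), f r ∂Measure.volumeIoiPow (Module.finrank ℝ E - 1) := by
      have := lintegral_prod_mul (μ := μ.toSphere)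
        (ν := Measure.volumeIoiPow (Module.finrank ℝ E - 1)) (f := fun _ => 1)
        (g := fun r => f r) aemeasurable_const (hf.comp measurable_subtype_coe).aemeasurable
      simpa using this
    _ = _ := by
      rw [Measure.volumeIoiPow, lintegral_withDensity_eq_lintegral_mul (g := fun r : Set.Ioi (0 : ℝ) => f r) _
        (by fun_prop) (hf.comp measurable_subtype_coe)]
      congr 1
      exact lintegral_subtype_comap measurableSet_Ioi
        fun r => ENNReal.ofReal (r ^ (Module.finrank ℝ E - 1)) * f r

/-- Complete `x` to an orthonormal basis and split off the coordinate along `x`. -/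
theorem exists_measurePreserving_inner_prod (d : ℕ) (x : UnitSphere d) :
    ∃ Ψ : EuclideanSpace ℝ (Fin (d + 1)) → ℝ × EuclideanSpace ℝ (Fin d),
      MeasurePreserving Ψ ∧ (∀ z, (Ψ z).1 = inner ℝ (x : EuclideanSpace ℝ (Fin (d + 1))) z) ∧
      ∀ z, ‖z‖ ^ 2 = (Ψ z).1 ^ 2 + ‖(Ψ z).2‖ ^ 2 := by
  have hx : ‖(x : EuclideanSpace ℝ (Fin (d + 1)))‖ = 1 := by simp
  obtain ⟨b, hb⟩ := Orthonormal.exists_orthonormalBasis_extension_of_card_eq (𝕜 := ℝ)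
    (E := EuclideanSpace ℝ (Fin (d + 1))) (ι := Fin (d + 1)) (by simp)
    (v := fun _ => (x : EuclideanSpace ℝ (Fin (d + 1)))) (s := {0}) (by
      refine ⟨fun i => by simp, fun i j hij => ?_⟩
      exact absurd (Subsingleton.elim i j) hij)
  have hb0 : b 0 = x := hb 0 rfl
  refine ⟨Prod.map id (WithLp.toLp 2) ∘ MeasurableEquiv.piFinSuccAbove (fun _ => ℝ) 0 ∘
    WithLp.ofLp ∘ b.repr, ?_, fun z => ?_, fun z => ?_⟩
  · exact ((MeasurePreserving.id _).prod (PiLp.volume_preserving_toLp (Fin d))).comp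
      ((volume_preserving_piFinSuccAbove (fun _ => ℝ) 0).comp
        ((PiLp.volume_preserving_ofLp _).comp b.measurePreserving_repr))
  · simp [MeasurableEquiv.piFinSuccAbove, b.repr_apply_apply, hb0]
  · rw [← b.repr.norm_map z, EuclideanSpace.real_norm_sq_eq, Fin.sum_univ_succ,
      EuclideanSpace.real_norm_sq_eq]
    simp [MeasurableEquiv.piFinSuccAbove, Fin.tail]

/-- The unnormalized distribution of the angle to a fixed point of the sphere. -/
noncomputable def sinPowMass (d : ℕ) (A : Set ℝ) : ENNReal :=
  ∫⁻ θ in Set.Ioo 0 Real.pi ∩ A, ENNReal.ofReal (Real.sin θ ^ (d - 1))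

/-- Integrating out directions orthogonal to `x` leaves the half-plane `(t, ρ)` with weight
`ρ^(d-1)`. Planar polar coordinates turn this into `r^d sin^(d-1) θ`. The factor `K` is the same for
all `A`, so it cancels on normalization. -/
theorem exists_volume_sector_eq (d : ℕ) (hd : 1 ≤ d) (x : UnitSphere d) :
    ∃ K : ENNReal, ∀ A : Set ℝ, MeasurableSet A →
      volume {z : EuclideanSpace ℝ (Fin (d + 1)) |
        ‖z‖ < 1 ∧ InnerProductGeometry.angle (x : EuclideanSpace ℝ (Fin (d + 1))) z ∈ A} =
      K * sinPowMass d A := by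
  have hx : ‖(x : EuclideanSpace ℝ (Fin (d + 1)))‖ = 1 := by simp
  have : Nonempty (Fin d) := ⟨⟨0, hd⟩⟩
  obtain ⟨Ψ, hΨ, hΨ1, hΨ2⟩ := exists_measurePreserving_inner_prod d x
  refine ⟨(volume : Measure (EuclideanSpace ℝ (Fin d))).toSphere Set.univ *
    ∫⁻ r in Set.Ioo (0 : ℝ) 1, ENNReal.ofReal (r ^ d), fun A hA => ?_⟩
  let D : Set (ℝ × ℝ) := {p | Real.sqrt (p.1 ^ 2 + p.2 ^ 2) < 1 ∧
    Real.arccos (p.1 / Real.sqrt (p.1 ^ 2 + p.2 ^ 2)) ∈ A}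
  have hD : MeasurableSet D := by
    refine MeasurableSet.inter (measurableSet_lt (f := fun p : ℝ × ℝ =>
      Real.sqrt (p.1 ^ 2 + p.2 ^ 2)) (by fun_prop) measurable_const) ?_
    exact (show Measurable fun p : ℝ × ℝ => Real.arccos (p.1 / Real.sqrt (p.1 ^ 2 + p.2 ^ 2)) from
      Real.measurable_arccos.comp (by fun_prop)) hA
  let F : ℝ × ℝ → ENNReal := D.indicator 1
  have hF : Measurable F := measurable_one.indicator hD
  have hset : {z : EuclideanSpace ℝ (Fin (d + 1)) |
        ‖z‖ < 1 ∧ InnerProductGeometry.angle (x : EuclideanSpace ℝ (Fin (d + 1))) z ∈ A} =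
      Ψ ⁻¹' {p | (p.1, ‖p.2‖) ∈ D} := by
    ext z
    have hz : Real.sqrt ((Ψ z).1 ^ 2 + ‖(Ψ z).2‖ ^ 2) = ‖z‖ := by
      rw [← hΨ2, Real.sqrt_sq (norm_nonneg _)]
    simp only [Set.mem_ofPred_eq, Set.mem_preimage, D, hz]
    simp only [hΨ1, InnerProductGeometry.angle, hx, one_mul]
  have hD' : MeasurableSet {p : ℝ × EuclideanSpace ℝ (Fin d) | (p.1, ‖p.2‖) ∈ D} :=
    (measurable_fst.prodMk measurable_snd.norm) hD
  -- Polar coordinates cover the whole plane; for `θ ≤ 0` both sides vanish because `ρ` must be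
  -- positive.
  have hpolar : ∀ p ∈ polarCoord.target, ENNReal.ofReal p.1 • (Set.univ ×ˢ Set.Ioi (0 : ℝ)).indicator
      (fun p : ℝ × ℝ => ENNReal.ofReal (p.2 ^ (d - 1)) * F p) (polarCoord.symm p) =
      (Set.Ioo (0 : ℝ) 1).indicator (fun r => ENNReal.ofReal (r ^ d)) p.1 *
      (Set.Ioo 0 Real.pi ∩ A).indicator (fun θ => ENNReal.ofReal (Real.sin θ ^ (d - 1))) p.2 := by
    rintro ⟨r, θ⟩ ⟨hr, hθ⟩
    simp only [Set.mem_Ioi, Set.mem_Ioo] at hr hθ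
    have hnorm : (r * Real.cos θ) ^ 2 + (r * Real.sin θ) ^ 2 = r ^ 2 := by
      rw [mul_pow, mul_pow, ← mul_add, Real.cos_sq_add_sin_sq, mul_one]
    simp only [polarCoord_symm_apply, smul_eq_mul]
    by_cases hθ0 : 0 < θ
    · have hs : 0 < Real.sin θ := Real.sin_pos_of_pos_of_lt_pi hθ0 hθ.2
      have hmem : (r * Real.cos θ, r * Real.sin θ) ∈ D ↔ r < 1 ∧ θ ∈ A := by
        simp only [D, Set.mem_ofPred_eq, hnorm, Real.sqrt_sq hr.le]
        rw [mul_div_cancel_left₀ _ hr.ne', Real.arccos_cos hθ0.le hθ.2.le]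
      rw [Set.indicator_of_mem (by simp [mul_pos hr hs])]
      by_cases h : r < 1 ∧ θ ∈ A
      · simp only [F]
        rw [Set.indicator_of_mem (hmem.2 h), Set.indicator_of_mem (by simp [hr, h.1]),
          Set.indicator_of_mem (by simp [hθ0, hθ.2, h.2])]
        simp only [Pi.one_apply, mul_one]
        rw [← ENNReal.ofReal_mul hr.le, ← ENNReal.ofReal_mul (by positivity), mul_pow, ← mul_assoc,
          ← pow_succ', Nat.sub_add_cancel hd]
      · simp only [F]
        rw [Set.indicator_of_notMem (fun hh => h (hmem.1 hh))]
        rcases not_and_or.1 h with h1 | h1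
        · rw [Set.indicator_of_notMem (s := Set.Ioo (0 : ℝ) 1) (by simp [h1])]
          simp
        · rw [Set.indicator_of_notMem (s := Set.Ioo 0 Real.pi ∩ A) (by simp [h1])]
          simp
    · have hs : Real.sin θ ≤ 0 := Real.sin_nonpos_of_nonpos_of_neg_pi_le (not_lt.1 hθ0) hθ.1.le
      rw [Set.indicator_of_notMem (by simp [mul_nonpos_of_nonneg_of_nonpos hr.le hs]),
        Set.indicator_of_notMem (s := Set.Ioo 0 Real.pi ∩ A) (by simp [hθ0])]
      simp
  calc
    _ = ∫⁻ p : ℝ × EuclideanSpace ℝ (Fin d), F (p.1, ‖p.2‖) := by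
      rw [hset, hΨ.measure_preimage hD'.nullMeasurableSet, ← lintegral_indicator_one hD']
      rfl
    _ = ∫⁻ t : ℝ, ∫⁻ u : EuclideanSpace ℝ (Fin d), F (t, ‖u‖) := by
      rw [Measure.volume_eq_prod, lintegral_prod _ (by fun_prop)]
    _ = ∫⁻ t : ℝ, (volume : Measure (EuclideanSpace ℝ (Fin d))).toSphere Set.univ *
          ∫⁻ ρ in Set.Ioi (0 : ℝ), ENNReal.ofReal (ρ ^ (d - 1)) * F (t, ρ) := by
      refine lintegral_congr fun t => ?_
      rw [lintegral_fun_norm_eq_toSphere_mul volume (f := fun ρ => F (t, ρ)) (by fun_prop)]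
      simp
    _ = (volume : Measure (EuclideanSpace ℝ (Fin d))).toSphere Set.univ *
          ∫⁻ p : ℝ × ℝ, (Set.univ ×ˢ Set.Ioi (0 : ℝ)).indicator
            (fun p : ℝ × ℝ => ENNReal.ofReal (p.2 ^ (d - 1)) * F p) p := by
      rw [lintegral_const_mul' _ _ (measure_ne_top _ _),
        lintegral_indicator (MeasurableSet.univ.prod measurableSet_Ioi), Measure.volume_eq_prod,
        ← Measure.prod_restrict, lintegral_prod _ (by fun_prop), Measure.restrict_univ]
    _ = _ := by
      rw [mul_assoc, ← lintegral_comp_polarCoord_symm,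
        setLIntegral_congr_fun polarCoord.open_target.measurableSet hpolar, polarCoord_target,
        Measure.volume_eq_prod, ← Measure.prod_restrict, lintegral_prod_mul
          (((Measurable.ennreal_ofReal (by fun_prop)).indicator measurableSet_Ioo).aemeasurable)
          (((Measurable.ennreal_ofReal (by fun_prop)).indicator
            (measurableSet_Ioo.inter hA)).aemeasurable),
        setLIntegral_indicator measurableSet_Ioo,
        setLIntegral_indicator (measurableSet_Ioo.inter hA), sinPowMass]
      congr 3
      · rw [Set.inter_eq_left.2 Set.Ioo_subset_Ioi_self]
      · rw [Set.inter_eq_left.2]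
        exact fun θ hθ => ⟨by linarith [hθ.1.1, Real.pi_pos], hθ.1.2⟩

/-- The product of consecutive Wallis integrals is exactly `2π / (n + 1)`, and the integrals
decrease in `n`. -/
theorem two_pi_div_le_sq_integral_sin_pow (n : ℕ) :
    2 * Real.pi / (n + 1) ≤ (∫ θ in (0 : ℝ)..Real.pi, Real.sin θ ^ n) ^ 2 := by
  have key : ∀ n : ℕ, (∫ θ in (0 : ℝ)..Real.pi, Real.sin θ ^ n) *
      (∫ θ in (0 : ℝ)..Real.pi, Real.sin θ ^ (n + 1)) = 2 * Real.pi / (n + 1) := by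
    intro n
    induction n with
    | zero => simp [integral_sin]; ring
    | succ n ih =>
      rw [integral_sin_pow (n := n)]
      simp only [Real.sin_zero, Real.sin_pi, ne_eq, Nat.add_eq_zero_iff, one_ne_zero, and_false,
        not_false_eq_true, zero_pow, zero_mul, sub_zero, zero_div, zero_add]
      rw [mul_comm, mul_assoc, ih]
      push_cast
      field_simp
      ring
  rw [← key n, sq]
  exact mul_le_mul_of_nonneg_left (integral_sin_pow_succ_le n) (integral_sin_pow_pos n).le

theorem ofReal_two_div_sqrt_le_sinPowMass_univ (d : ℕ) (hd : 1 ≤ d) :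
    ENNReal.ofReal (2 / Real.sqrt d) ≤ sinPowMass d Set.univ := by
  have h := two_pi_div_le_sq_integral_sin_pow (d - 1)
  have hd' : ((d - 1 : ℕ) : ℝ) + 1 = d := by exact_mod_cast Nat.sub_add_cancel hd
  have hd0 : (0 : ℝ) < d := by exact_mod_cast hd
  rw [hd'] at h
  have hi : 2 / Real.sqrt d ≤ ∫ θ in (0 : ℝ)..Real.pi, Real.sin θ ^ (d - 1) := by
    refine le_of_sq_le_sq ?_ (integral_sin_pow_pos _).le
    refine le_trans ?_ h
    rw [div_pow, Real.sq_sqrt hd0.le]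
    gcongr
    linarith [Real.pi_gt_three]
  refine (ENNReal.ofReal_le_ofReal hi).trans (le_of_eq ?_)
  rw [sinPowMass, Set.inter_univ, intervalIntegral.integral_of_le Real.pi_pos.le,
    integral_Ioc_eq_integral_Ioo, ofReal_integral_eq_lintegral_ofReal]
  · exact ((by fun_prop : Continuous fun θ => Real.sin θ ^ (d - 1)).integrableOn_Icc).mono_set
      Set.Ioo_subset_Icc_self
  · filter_upwards [ae_restrict_mem measurableSet_Ioo] with θ hθ
    exact pow_nonneg (Real.sin_pos_of_pos_of_lt_pi hθ.1 hθ.2).le _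

theorem sinPowMass_le_volume (d : ℕ) (A : Set ℝ) : sinPowMass d A ≤ volume A := by
  calc sinPowMass d A ≤ ∫⁻ θ in Set.Ioo 0 Real.pi ∩ A, 1 := by
        refine lintegral_mono fun θ => ?_
        rw [← ENNReal.ofReal_one]
        refine ENNReal.ofReal_le_ofReal (le_trans (le_abs_self _) ?_)
        rw [abs_pow]
        exact pow_le_one₀ (abs_nonneg _) (Real.abs_sin_le_one _)
    _ ≤ volume A := by
        rw [setLIntegral_one]
        exact measure_mono Set.inter_subset_right

instance isProbabilityMeasure_sphereMeasure (d : ℕ) : IsProbabilityMeasure (sphereMeasure d) :=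
  ⟨by
    rw [sphereMeasure, Measure.smul_apply, smul_eq_mul]
    exact ENNReal.inv_mul_cancel (Measure.measure_univ_ne_zero.2 (Measure.toSphere_ne_zero _))
      (measure_ne_top _ _)⟩

open scoped Pointwise in
-- Surface measure is the volume of the cone over a set, up to normalization, and the angle to `x`
-- is constant along rays. Dividing by the case of the full ball removes `K`.
theorem sphereMeasure_angle_mul_le (d : ℕ) (hd : 1 ≤ d) (x : UnitSphere d) (A : Set ℝ)
    (hA : MeasurableSet A) :
    sphereMeasure d {y | InnerProductGeometry.angle (x : EuclideanSpace ℝ (Fin (d + 1))) y ∈ A} *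
      sinPowMass d Set.univ ≤ sinPowMass d A := by
  obtain ⟨K, hK⟩ := exists_volume_sector_eq d hd x
  let C : Set ℝ → Set (EuclideanSpace ℝ (Fin (d + 1))) := fun A => {z |
        ‖z‖ < 1 ∧ InnerProductGeometry.angle (x : EuclideanSpace ℝ (Fin (d + 1))) z ∈ A}
  have hball : volume (Metric.ball (0 : EuclideanSpace ℝ (Fin (d + 1))) 1) =
      K * sinPowMass d Set.univ := by
    rw [← hK _ MeasurableSet.univ]
    congr 1
    ext z
    simp
  have hmeas : MeasurableSet
      {y : UnitSphere d | InnerProductGeometry.angle (x : EuclideanSpace ℝ (Fin (d + 1))) y ∈ A} := by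
    refine (show Measurable fun y : UnitSphere d =>
      InnerProductGeometry.angle (x : EuclideanSpace ℝ (Fin (d + 1))) y from ?_) hA
    unfold InnerProductGeometry.angle
    exact Real.measurable_arccos.comp (by fun_prop)
  have hsub : Set.Ioo (0 : ℝ) 1 • (Subtype.val '' {y : UnitSphere d |
      InnerProductGeometry.angle (x : EuclideanSpace ℝ (Fin (d + 1))) y ∈ A}) ⊆ C A := by
    rintro _ ⟨r, hr, _, ⟨y, hy, rfl⟩, rfl⟩
    have hy1 : ‖(y : EuclideanSpace ℝ (Fin (d + 1)))‖ = 1 := by simp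
    refine ⟨?_, ?_⟩
    · simp only [norm_smul, hy1, mul_one, Real.norm_eq_abs, abs_of_pos hr.1]
      exact hr.2
    · simpa [InnerProductGeometry.angle_smul_right_of_pos _ _ hr.1] using hy
  have hvol : sphereMeasure d
      {y | InnerProductGeometry.angle (x : EuclideanSpace ℝ (Fin (d + 1))) y ∈ A} ≤
      (K * sinPowMass d Set.univ)⁻¹ * (K * sinPowMass d A) := by
    have hn0 : ((d + 1 : ℕ) : ENNReal) ≠ 0 := by simp
    have hnt : ((d + 1 : ℕ) : ENNReal) ≠ ⊤ := ENNReal.natCast_ne_top _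
    rw [sphereMeasure, Measure.smul_apply, smul_eq_mul, Measure.toSphere_apply_univ,
      Measure.toSphere_apply' _ hmeas, hball, finrank_euclideanSpace_fin,
      ENNReal.mul_inv (Or.inl hn0) (Or.inl hnt), ← hK A hA]
    calc _ ≤ (((d + 1 : ℕ) : ENNReal)⁻¹ * (K * sinPowMass d Set.univ)⁻¹) *
          (((d + 1 : ℕ) : ENNReal) * volume (C A)) := by gcongr
      _ = (((d + 1 : ℕ) : ENNReal)⁻¹ * ((d + 1 : ℕ) : ENNReal)) *
          ((K * sinPowMass d Set.univ)⁻¹ * volume (C A)) := by ring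
      _ = _ := by rw [ENNReal.inv_mul_cancel hn0 hnt, one_mul]
  have h0 : K * sinPowMass d Set.univ ≠ 0 := by
    rw [← hball]
    exact (Metric.measure_ball_pos _ _ one_pos).ne'
  have ht : K * sinPowMass d Set.univ ≠ ⊤ := by
    rw [← hball]
    exact measure_ball_lt_top.ne
  calc _ ≤ (K * sinPowMass d Set.univ)⁻¹ * (K * sinPowMass d A) * sinPowMass d Set.univ := by
        gcongr
    _ = (K * sinPowMass d Set.univ)⁻¹ * (K * sinPowMass d Set.univ) * sinPowMass d A := by ring
    _ = _ := by rw [ENNReal.inv_mul_cancel h0 ht, one_mul]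

/-- The unnormalized angular density is at most `1` and its total mass at least `2 / √d`, while the
interval has length `2η`. -/
theorem sphereMeasure_band_le (d : ℕ) (hd : 1 ≤ d) (x : UnitSphere d) (α η : ℝ) :
    sphereMeasure d {y | |InnerProductGeometry.angle (x : EuclideanSpace ℝ (Fin (d + 1))) y - α| ≤ η}
      ≤ ENNReal.ofReal (η * Real.sqrt d) := by
  have hd0 : (0 : ℝ) < Real.sqrt d := Real.sqrt_pos.2 (by exact_mod_cast hd)
  have h := sphereMeasure_angle_mul_le d hd x (Metric.closedBall α η) measurableSet_closedBall
  have h' := (mul_le_mul_right (ofReal_two_div_sqrt_le_sinPowMass_univ d hd) _).trans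
    (h.trans (sinPowMass_le_volume d _))
  rw [Real.volume_closedBall] at h'
  have h2 := ENNReal.le_div_iff_mul_le (Or.inl (by simp [hd0])) (Or.inl ENNReal.ofReal_ne_top)
    |>.2 h'
  rw [← ENNReal.ofReal_div_of_pos (by positivity)] at h2
  have h3 : 2 * η / (2 / Real.sqrt d) = η * Real.sqrt d := by
    field_simp
  rwa [h3] at h2

theorem angle_le_mul_norm_sub_of_norm_eq_one {V : Type*} [NormedAddCommGroup V]
    [InnerProductSpace ℝ V] {x y : V} (hx : ‖x‖ = 1) (hy : ‖y‖ = 1) :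
    InnerProductGeometry.angle x y ≤ Real.pi / 2 * ‖x - y‖ := by
  set θ := InnerProductGeometry.angle x y with hθ
  have h0 : 0 ≤ θ := InnerProductGeometry.angle_nonneg _ _
  have hpi : θ ≤ Real.pi := InnerProductGeometry.angle_le_pi _ _
  have hcos : Real.cos θ = inner ℝ x y := by
    rw [hθ, InnerProductGeometry.cos_angle, hx, hy]
    simp
  have hsq : (2 * Real.sin (θ / 2)) ^ 2 = ‖x - y‖ ^ 2 := by
    rw [norm_sub_sq_real, hx, hy, ← hcos, mul_pow, Real.sin_sq_eq_half_sub]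
    ring_nf
  have hs : 2 * Real.sin (θ / 2) = ‖x - y‖ := by
    refine (pow_left_inj₀ ?_ (norm_nonneg _) two_ne_zero).1 hsq
    exact mul_nonneg zero_le_two (Real.sin_nonneg_of_nonneg_of_le_pi (by linarith) (by linarith))
  -- Jordan's inequality, applied to the half-angle formula for the chord.
  have hj := Real.mul_le_sin (x := θ / 2) (by linarith) (by linarith)
  rw [← hs]
  have := mul_le_mul_of_nonneg_left hj Real.pi_pos.le
  have h3 : Real.pi * (2 / Real.pi * (θ / 2)) = θ := by
    field_simp
  linarith

/-! ### Economical coverings of the sphere -/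

theorem pow_succ_sub_pow_succ_le {a b : ℝ} (hb : 0 ≤ b) (hab : b ≤ a) (n : ℕ) :
    a ^ (n + 1) - b ^ (n + 1) ≤ (n + 1) * (a - b) * a ^ n := by
  induction n with
  | zero => simp
  | succ n ih =>
    have h1 := mul_le_mul_of_nonneg_left ih (hb.trans hab)
    have h2 := mul_le_mul_of_nonneg_left (pow_le_pow_left₀ hb hab (n + 1)) (sub_nonneg.2 hab)
    push_cast
    calc a ^ (n + 1 + 1) - b ^ (n + 1 + 1)
        = a * (a ^ (n + 1) - b ^ (n + 1)) + (a - b) * b ^ (n + 1) := by ring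
      _ ≤ a * ((n + 1) * (a - b) * a ^ n) + (a - b) * a ^ (n + 1) := add_le_add h1 h2
      _ = _ := by ring

theorem two_mul_succ_le_four_pow {d : ℕ} (hd : 1 ≤ d) : 2 * ((d : ℝ) + 1) ≤ 4 ^ d := by
  induction d, hd using Nat.le_induction with
  | base => norm_num
  | succ n hn ih =>
    push_cast
    rw [pow_succ]
    have : (1 : ℝ) ≤ n := by exact_mod_cast hn
    linarith

/-- Disjoint balls of radius `u = δ / 2` are packed into the shell between radii `1 - u` and `1 +
u`, whose volume carries a factor `u`. Packing into a full ball would give exponent `d + 1` instead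
of `d`. -/
theorem card_le_of_separated (d : ℕ) (hd : 1 ≤ d) {δ : ℝ} (hδ : 0 < δ) (hδ2 : δ ≤ 2)
    (T : Finset (UnitSphere d)) (hT : ∀ t ∈ T, ∀ t' ∈ T, t ≠ t' → δ ≤ dist t t') :
    (T.card : ℝ) ≤ (16 / δ) ^ d := by
  let v : ℝ := volume.real (Metric.ball (0 : EuclideanSpace ℝ (Fin (d + 1))) 1)
  have hv : 0 < v := ENNReal.toReal_pos (Metric.measure_ball_pos _ _ one_pos).ne'
    measure_ball_lt_top.ne
  obtain ⟨u, rfl⟩ : ∃ u, δ = 2 * u := ⟨δ / 2, by ring⟩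
  have hu : 0 < u := by linarith
  have hball : ∀ (z : EuclideanSpace ℝ (Fin (d + 1))) (r : ℝ), 0 ≤ r →
      volume.real (Metric.ball z r) = r ^ (d + 1) * v := by
    intro z r hr
    rw [measureReal_def, Measure.addHaar_ball _ _ hr, ENNReal.toReal_mul,
      ENNReal.toReal_ofReal (by positivity), finrank_euclideanSpace_fin]
    rfl
  have hdisj : Set.PairwiseDisjoint (T : Set (UnitSphere d))
      fun t => Metric.ball (t : EuclideanSpace ℝ (Fin (d + 1))) u := by
    intro t ht t' ht' hne
    refine Metric.ball_disjoint_ball ?_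
    have := hT t ht t' ht' hne
    rw [Subtype.dist_eq] at this
    linarith
  have hsub : (⋃ t ∈ T, Metric.ball (t : EuclideanSpace ℝ (Fin (d + 1))) u) ⊆
      Metric.ball (0 : EuclideanSpace ℝ (Fin (d + 1))) (1 + u) \ Metric.ball 0 (1 - u) := by
    refine Set.iUnion₂_subset fun t _ z hz => ?_
    have ht : ‖(t : EuclideanSpace ℝ (Fin (d + 1)))‖ = 1 := by simp
    rw [Metric.mem_ball, dist_eq_norm] at hz
    have h1 : ‖z‖ ≤ ‖z - t‖ + ‖(t : EuclideanSpace ℝ (Fin (d + 1)))‖ := by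
      simpa using norm_add_le (z - t) (t : EuclideanSpace ℝ (Fin (d + 1)))
    have h2 : ‖(t : EuclideanSpace ℝ (Fin (d + 1)))‖ ≤ ‖z - t‖ + ‖z‖ := by
      rw [norm_sub_rev]
      simpa using norm_add_le ((t : EuclideanSpace ℝ (Fin (d + 1))) - z) z
    simp only [Set.mem_sdiff, mem_ball_zero_iff, not_lt]
    constructor <;> linarith
  have hle := measureReal_mono hsub (measure_ne_top_of_subset Set.sdiff_subset
    measure_ball_lt_top.ne) (μ := volume)
  rw [measureReal_biUnion_finset hdisj (fun _ _ => measurableSet_ball)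
      (fun _ _ => measure_ball_lt_top.ne),
    measureReal_sdiff (Metric.ball_subset_ball (by linarith)) measurableSet_ball
      measure_ball_lt_top.ne,
    Finset.sum_congr rfl (fun (t : UnitSphere d) _ => hball t u hu.le),
    hball _ _ (by linarith), hball _ _ (by linarith), Finset.sum_const, nsmul_eq_mul,
    ← sub_mul, ← mul_assoc] at hle
  have hle' := le_of_mul_le_mul_right hle hv
  have h2 := hle'.trans (pow_succ_sub_pow_succ_le (by linarith) (by linarith) d)
  have h3 : (T.card : ℝ) * u ^ d ≤ 2 * (d + 1) * (1 + u) ^ d := by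
    rw [pow_succ] at h2
    refine le_of_mul_le_mul_right ?_ hu
    linarith
  have h4 : (T.card : ℝ) * u ^ d ≤ (8 : ℝ) ^ d := by
    calc _ ≤ _ := h3
      _ ≤ 4 ^ d * 2 ^ d := by
        gcongr
        · exact two_mul_succ_le_four_pow hd
        · linarith
      _ = _ := by rw [← mul_pow]; norm_num
  rw [show 16 / (2 * u) = 8 / u by field_simp; norm_num, div_pow, le_div_iff₀ (by positivity)]
  exact h4

theorem exists_sphere_cover (d : ℕ) (hd : 1 ≤ d) {δ : ℝ} (hδ : 0 < δ) :
    ∃ (n : ℕ) (e : Fin n → UnitSphere d), (∀ y, ∃ k, dist y (e k) ≤ δ) ∧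
      (n = 1 ∨ (n : ℝ) ≤ (16 / δ) ^ d) := by
  -- For `δ > 2` one point covers the sphere, and the packing bound is not available; hence the
  -- alternative `n = 1`. Otherwise a maximal separated set is a cover.
  rcases lt_or_ge 2 δ with h2 | h2
  · let y₀ : UnitSphere d := ⟨EuclideanSpace.single 0 1, by simp⟩
    refine ⟨1, fun _ => y₀, fun y => ⟨0, ?_⟩, Or.inl rfl⟩
    have hy : ‖(y : EuclideanSpace ℝ (Fin (d + 1)))‖ = 1 := by simp
    have hy' : ‖(y₀ : EuclideanSpace ℝ (Fin (d + 1)))‖ = 1 := by simp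
    rw [Subtype.dist_eq, dist_eq_norm]
    linarith [norm_sub_le (y : EuclideanSpace ℝ (Fin (d + 1))) y₀]
  let S : Set ℕ := {n | ∃ T : Finset (UnitSphere d),
    (∀ t ∈ T, ∀ t' ∈ T, t ≠ t' → δ ≤ dist t t') ∧ T.card = n}
  have hne : S.Nonempty := ⟨0, ∅, by simp⟩
  have hbdd : BddAbove S := by
    refine ⟨⌈(16 / δ) ^ d⌉₊, ?_⟩
    rintro _ ⟨T, hT, rfl⟩
    exact_mod_cast (card_le_of_separated d hd hδ h2 T hT).trans (Nat.le_ceil _)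
  obtain ⟨T, hT, hcard⟩ := Nat.sSup_mem hne hbdd
  refine ⟨T.card, fun k => (T.equivFin.symm k : UnitSphere d), fun y => ?_,
    Or.inr (card_le_of_separated d hd hδ h2 T hT)⟩
  by_contra! hfar
  have hfar' : ∀ t ∈ T, δ < dist y t := fun t ht => by
    simpa using hfar (T.equivFin ⟨t, ht⟩)
  have hyT : y ∉ T := fun hy => by
    have := hfar' y hy
    rw [dist_self] at this
    linarith
  classical
  have hmem : (insert y T).card ∈ S := by
    refine ⟨insert y T, ?_, rfl⟩
    intro t ht t' ht' hne
    rcases Finset.mem_insert.1 ht with rfl | h <;> rcases Finset.mem_insert.1 ht' with rfl | h'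
    · exact absurd rfl hne
    · exact (hfar' t' h').le
    · rw [dist_comm]
      exact (hfar' t h).le
    · exact hT t h t' h' hne
  have := le_csSup hbdd hmem
  rw [Finset.card_insert_of_notMem hyT] at this
  omega

/-! ### Piecewise polynomials away from the knots -/

theorem Polynomial.eval_inner_mem_sphericalPolynomials (d r : ℕ) (p : Polynomial ℝ)
    (hp : p.natDegree ≤ r) (x : UnitSphere d) :
    (fun y : UnitSphere d => p.eval (inner ℝ (x : EuclideanSpace ℝ (Fin (d + 1))) y)) ∈
      sphericalPolynomials d r := by
  let L : MvPolynomial (Fin (d + 1)) ℝ :=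
    ∑ i, MvPolynomial.C ((x : EuclideanSpace ℝ (Fin (d + 1))) i) * MvPolynomial.X i
  have hL : L.totalDegree ≤ 1 := by
    refine MvPolynomial.totalDegree_finsetSum_le fun i _ => ?_
    refine (MvPolynomial.totalDegree_mul _ _).trans ?_
    simp
  refine ⟨Polynomial.aeval L p, ?_, ?_⟩
  · rw [SetLike.mem_coe, MvPolynomial.mem_restrictTotalDegree, Polynomial.aeval_eq_sum_range]
    refine MvPolynomial.totalDegree_finsetSum_le fun i hi => ?_
    refine (MvPolynomial.totalDegree_smul_le _ _).trans
      ((MvPolynomial.totalDegree_pow _ _).trans ?_)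
    have : i ≤ r := (Nat.lt_succ_iff.1 (Finset.mem_range.1 hi)).trans hp
    exact (Nat.mul_le_mul_left i hL).trans (by simpa using this)
  · funext y
    have hLy : MvPolynomial.eval (fun i => (y : EuclideanSpace ℝ (Fin (d + 1))) i) L =
        inner ℝ (x : EuclideanSpace ℝ (Fin (d + 1))) y := by
      simp [L, PiLp.inner_apply, mul_comm]
    simp only [restrictToSphere, LinearMap.coe_mk, AddHom.coe_mk]
    rw [Polynomial.aeval_eq_sum_range, Polynomial.eval_eq_sum_range]
    simp [hLy, MvPolynomial.smul_eval]

instance finiteDimensional_sphericalPolynomials (d r : ℕ) :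
    FiniteDimensional ℝ (sphericalPolynomials d r) := by
  unfold sphericalPolynomials
  infer_instance

theorem IsPiecewisePolynomial.pos {r ℓ : ℕ} {s : Fin (ℓ + 1) → ℝ} {Φ : ℝ → ℝ}
    (hΦ : IsPiecewisePolynomial r ℓ s Φ) : 1 ≤ ℓ := by
  rcases Nat.eq_zero_or_pos ℓ with rfl | h
  · have h1 := hΦ.first
    have h2 := hΦ.last
    rw [Fin.last_zero, h1] at h2
    norm_num at h2
  · exact h

/-- Take the last knot not exceeding `min T`. The next knot exceeds `min T`, so by `hs` it bounds
all of `T`, which therefore lies in one closed piece. -/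
theorem IsPiecewisePolynomial.exists_eqOn_of_not_crossing {r ℓ : ℕ} {s : Fin (ℓ + 1) → ℝ}
    {Φ : ℝ → ℝ} (hΦ : IsPiecewisePolynomial r ℓ s Φ) {T : Set ℝ} (hT : T.Finite)
    (hT1 : T ⊆ Set.Icc (-1) 1) (hs : ∀ j, ∀ t ∈ T, ∀ t' ∈ T, t < s j → t' ≤ s j) :
    ∃ p : Polynomial ℝ, p.natDegree ≤ r ∧ ∀ t ∈ T, Φ t = p.eval t := by
  rcases T.eq_empty_or_nonempty with rfl | hne
  · exact ⟨0, by simp, by simp⟩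
  obtain ⟨t₀, ht₀, hmin⟩ := hT.exists_minimalFor id T hne
  have hmin' : ∀ t ∈ T, t₀ ≤ t := fun t ht => by
    rcases le_total t₀ t with h | h
    · exact h
    · exact hmin ht h
  obtain ⟨i, hi', himax⟩ : ∃ i, s i ≤ t₀ ∧ ∀ i', s i' ≤ t₀ → i' ≤ i := by
    classical
    let I : Finset (Fin (ℓ + 1)) := Finset.univ.filter fun i => s i ≤ t₀
    have hI : I.Nonempty := ⟨0, by simp [I, hΦ.first, (hT1 ht₀).1]⟩
    exact ⟨I.max' hI, by simpa [I] using I.max'_mem hI, fun i h => I.le_max' i (by simp [I, h])⟩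
  induction i using Fin.lastCases with
  | last =>
    rw [hΦ.last] at hi'
    have hℓ := hΦ.pos
    -- No piece starts at the knot `1`, so the piece ending there is used.
    let j : Fin ℓ := ⟨ℓ - 1, by omega⟩
    have hj : j.succ = Fin.last ℓ := Fin.ext (by simp [j]; omega)
    obtain ⟨p, hp, hpe⟩ := hΦ.eq_poly j
    refine ⟨p, hp, fun t ht => hpe t ⟨?_, ?_⟩⟩
    · have := (hΦ.strictMono (Fin.castSucc_lt_succ (i := j))).le
      rw [hj, hΦ.last] at this
      linarith [hmin' t ht]
    · rw [hj, hΦ.last]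
      exact (hT1 ht).2
  | cast j =>
    obtain ⟨p, hp, hpe⟩ := hΦ.eq_poly j
    refine ⟨p, hp, fun t ht => hpe t ⟨hi'.trans (hmin' t ht), hs _ t₀ ht₀ t ht ?_⟩⟩
    by_contra! h
    exact absurd (himax _ h) (not_le.2 (Fin.castSucc_lt_succ (i := j)))

/-! ### Discretization of the integral -/

/-- Choosing the smallest admissible index makes each fibre a closed ball minus finitely many closed
balls. -/
theorem exists_measurable_nearby_index {α : Type*} [PseudoMetricSpace α] [MeasurableSpace α]
    [OpensMeasurableSpace α] {n : ℕ} {ε : ℝ} (e : Fin n → α) (he : ∀ y, ∃ k, dist y (e k) ≤ ε) :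
    ∃ f : α → Fin n, Measurable f ∧ ∀ y, dist y (e (f y)) ≤ ε := by
  classical
  have hne : ∀ y, (Finset.univ.filter fun k => dist y (e k) ≤ ε).Nonempty := fun y => by
    obtain ⟨k, hk⟩ := he y
    exact ⟨k, by simp [hk]⟩
  refine ⟨fun y => (Finset.univ.filter fun k => dist y (e k) ≤ ε).min' (hne y), ?_, fun y => ?_⟩
  · refine measurable_to_countable' fun k => ?_
    have : (fun y => (Finset.univ.filter fun k => dist y (e k) ≤ ε).min' (hne y)) ⁻¹' {k} =
        Metric.closedBall (e k) ε ∩ ⋂ j ∈ Finset.univ.filter (· < k),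
          (Metric.closedBall (e j) ε)ᶜ := by
      ext y
      simp only [Set.mem_preimage, Set.mem_singleton_iff, Finset.min'_eq_iff, Finset.mem_filter,
        Finset.mem_univ, true_and, Set.mem_inter_iff, Metric.mem_closedBall, Set.mem_iInter,
        Set.mem_compl_iff, not_le]
      refine and_congr_right fun _ => forall_congr' fun j => ?_
      rw [← not_imp_not, not_le, not_le]
    rw [this]
    exact measurableSet_closedBall.inter
      (Finset.measurableSet_biInter _ fun j _ => measurableSet_closedBall.compl)
  · have := Finset.min'_mem _ (hne y)
    simpa using this

theorem integral_eq_sum_setIntegral_preimage {α : Type*} [MeasurableSpace α] {μ : Measure α}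
    {n : ℕ} {f : α → Fin n} (hf : Measurable f) {h : α → ℝ} (hh : Integrable h μ) :
    ∫ y, h y ∂μ = ∑ k, ∫ y in f ⁻¹' {k}, h y ∂μ := by
  rw [← integral_iUnion_fintype (fun k => hf (measurableSet_singleton k))
    (fun i j hij => (Set.disjoint_singleton.2 hij).preimage f) (fun k => hh.integrableOn)]
  have : ⋃ k, f ⁻¹' {k} = Set.univ := by
    ext y
    simp
  rw [this, setIntegral_univ]

theorem abs_integral_sub_sum_le {α : Type*} [MeasurableSpace α] {μ : Measure α}
    [IsProbabilityMeasure μ] {n : ℕ} {f : α → Fin n} (hf : Measurable f) {g F : α → ℝ}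
    (hg : Integrable g μ) (hFg : Integrable (fun y => F y * g y) μ) (hg1 : ∀ᵐ y ∂μ, |g y| ≤ 1)
    {c : Fin n → ℝ} {ε : ℝ} (hc : ∀ y, |F y - c (f y)| ≤ ε) :
    |∫ y, F y * g y ∂μ - ∑ k, (∫ y in f ⁻¹' {k}, g y ∂μ) * c k| ≤ ε := by
  have hcg : Integrable (fun y => c (f y) * g y) μ := by
    refine hg.bdd_mul (c := ∑ k, |c k|)
      ((measurable_of_finite c).comp hf).aestronglyMeasurable ?_
    filter_upwards with y
    exact Finset.single_le_sum (f := fun k => |c k|) (fun k _ => abs_nonneg _)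
      (Finset.mem_univ (f y))
  have hsum : ∑ k, (∫ y in f ⁻¹' {k}, g y ∂μ) * c k = ∫ y, c (f y) * g y ∂μ := by
    rw [integral_eq_sum_setIntegral_preimage hf hcg]
    refine Finset.sum_congr rfl fun k _ => ?_
    rw [mul_comm, ← integral_const_mul]
    refine setIntegral_congr_fun (hf (measurableSet_singleton k)) fun y hy => ?_
    have hy' : f y = k := hy
    simp only [hy']
  rw [hsum, ← integral_sub hFg hcg]
  have := norm_integral_le_of_norm_le_const (μ := μ) (C := ε)
    (f := fun y => F y * g y - c (f y) * g y) (by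
      filter_upwards [hg1] with y hy
      rw [← sub_mul, norm_mul]
      calc _ ≤ ε * 1 := mul_le_mul (hc y) hy (abs_nonneg _) ((abs_nonneg _).trans (hc y))
        _ = ε := mul_one _)
  simpa using this

theorem abs_setIntegral_le_measureReal {α : Type*} [MeasurableSpace α] {μ : Measure α}
    [IsFiniteMeasure μ] {g : α → ℝ} (hg1 : ∀ᵐ y ∂μ, |g y| ≤ 1) (s : Set α) :
    |∫ y in s, g y ∂μ| ≤ μ.real s := by
  have := norm_setIntegral_le_of_norm_le_const_ae (μ := μ) (s := s) (C := 1) (f := g)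
    (measure_lt_top _ _) (ae_restrict_of_ae hg1)
  simpa using this

/-! ### The total mass of the cells crossed by a knot -/

/-- The cell `i` of the points `e k` with `c k = i` has points strictly on both sides of one of the
parallels `⟪x, ·⟫ = s j`. -/
def CellCrossed {d ℓ : ℕ} (s : Fin (ℓ + 1) → ℝ) {κ ι : Type*} (e : κ → UnitSphere d) (c : κ → ι)
    (x : UnitSphere d) (i : ι) : Prop :=
  ∃ j k k', c k = i ∧ c k' = i ∧ inner ℝ (x : EuclideanSpace ℝ (Fin (d + 1))) (e k) < s j ∧
    s j < inner ℝ (x : EuclideanSpace ℝ (Fin (d + 1))) (e k')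

theorem abs_inner_sub_inner_le {d : ℕ} (x y z : UnitSphere d) :
    |inner ℝ (x : EuclideanSpace ℝ (Fin (d + 1))) y -
      inner ℝ (x : EuclideanSpace ℝ (Fin (d + 1))) z| ≤ dist y z := by
  have hx : ‖(x : EuclideanSpace ℝ (Fin (d + 1)))‖ = 1 := by simp
  rw [← inner_sub_right, Subtype.dist_eq, dist_eq_norm]
  simpa [hx] using abs_real_inner_le_norm (x : EuclideanSpace ℝ (Fin (d + 1)))
    ((y : EuclideanSpace ℝ (Fin (d + 1))) - z)

theorem inner_mem_Icc {d : ℕ} (x y : UnitSphere d) :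
    inner ℝ (x : EuclideanSpace ℝ (Fin (d + 1))) y ∈ Set.Icc (-1 : ℝ) 1 := by
  have hx : ‖(x : EuclideanSpace ℝ (Fin (d + 1)))‖ = 1 := by simp
  have hy : ‖(y : EuclideanSpace ℝ (Fin (d + 1)))‖ = 1 := by simp
  have := abs_real_inner_le_norm (x : EuclideanSpace ℝ (Fin (d + 1))) y
  exact abs_le.1 (by simpa [hx, hy] using this)

theorem angle_eq_arccos_inner {d : ℕ} (x y : UnitSphere d) :
    InnerProductGeometry.angle (x : EuclideanSpace ℝ (Fin (d + 1))) y =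
      Real.arccos (inner ℝ (x : EuclideanSpace ℝ (Fin (d + 1))) y) := by
  have hx : ‖(x : EuclideanSpace ℝ (Fin (d + 1)))‖ = 1 := by simp
  have hy : ‖(y : EuclideanSpace ℝ (Fin (d + 1)))‖ = 1 := by simp
  rw [InnerProductGeometry.angle, hx, hy]
  simp

theorem abs_angle_sub_arccos_le {d : ℕ} {x y z z' : UnitSphere d} {t ρ : ℝ}
    (hz : inner ℝ (x : EuclideanSpace ℝ (Fin (d + 1))) z ≤ t)
    (hz' : t ≤ inner ℝ (x : EuclideanSpace ℝ (Fin (d + 1))) z') (hyz : dist y z ≤ ρ)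
    (hyz' : dist y z' ≤ ρ) :
    |InnerProductGeometry.angle (x : EuclideanSpace ℝ (Fin (d + 1))) y - Real.arccos t| ≤ 2 * ρ := by
  have hnorm : ∀ u : UnitSphere d, ‖(u : EuclideanSpace ℝ (Fin (d + 1)))‖ = 1 := fun u => by simp
  have hang : ∀ u v : UnitSphere d, dist u v ≤ ρ →
      InnerProductGeometry.angle (u : EuclideanSpace ℝ (Fin (d + 1))) v ≤ 2 * ρ := by
    intro u v h
    rw [Subtype.dist_eq, dist_eq_norm] at h
    have h1 := angle_le_mul_norm_sub_of_norm_eq_one (hnorm u) (hnorm v)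
    have h2 := mul_le_mul_of_nonneg_right Real.pi_le_four
      (norm_nonneg ((u : EuclideanSpace ℝ (Fin (d + 1))) - v))
    linarith
  have h1 := Real.arccos_le_arccos hz
  have h2 := Real.arccos_le_arccos hz'
  rw [← angle_eq_arccos_inner] at h1 h2
  have h3 := InnerProductGeometry.angle_le_angle_add_angle (x : EuclideanSpace ℝ (Fin (d + 1))) y z
  have h4 := InnerProductGeometry.angle_le_angle_add_angle (x : EuclideanSpace ℝ (Fin (d + 1))) z' y
  have h5 := hang y z hyz
  have h6 := hang z' y (by rwa [dist_comm])
  rw [abs_le]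
  constructor <;> linarith

open Classical in
-- A point whose net point lies in a crossed cell is within `ε + 2δ ≤ 3δ` of net points on both
-- sides of a parallel. Its angle to `x` is then within `6δ` of that parallel's angle, so the `ℓ +
-- 1` bands contain all such points.
theorem sum_cellCrossed_le {d : ℕ} (hd : 1 ≤ d) {ℓ : ℕ} (s : Fin (ℓ + 1) → ℝ) {n : ℕ} {ι : Type*}
    {e : Fin n → UnitSphere d} {f : UnitSphere d → Fin n} (hf : Measurable f) {ε δ : ℝ}
    (hfe : ∀ y, dist y (e (f y)) ≤ ε) (hεδ : ε ≤ δ) {c : Fin n → ι} {z : ι → UnitSphere d}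
    (hc : ∀ k, dist (e k) (z (c k)) ≤ δ) (x : UnitSphere d) :
    ∑ k, (if CellCrossed s e c x (c k) then (sphereMeasure d).real (f ⁻¹' {k}) else 0) ≤
      (ℓ + 1) * (6 * δ * Real.sqrt d) := by
  have hδ : 0 ≤ δ := dist_nonneg.trans (hc (f x))
  let band : Fin (ℓ + 1) → Set (UnitSphere d) := fun j =>
    {y | |InnerProductGeometry.angle (x : EuclideanSpace ℝ (Fin (d + 1))) y - Real.arccos (s j)| ≤
      6 * δ}
  rw [← Finset.sum_filter, ← measureReal_biUnion_finset
    (fun i _ j _ hij => (Set.disjoint_singleton.2 hij).preimage f)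
    (fun k _ => hf (measurableSet_singleton k))]
  calc _ ≤ (sphereMeasure d).real (⋃ j ∈ Finset.univ, band j) := by
        refine measureReal_mono (Set.iUnion₂_subset fun k hk y hy => ?_) (measure_ne_top _ _)
        obtain ⟨j, k₁, k₂, h₁, h₂, hlt₁, hlt₂⟩ := (Finset.mem_filter.1 hk).2
        have hyk : f y = k := hy
        have hdist : ∀ k', c k' = c k → dist y (e k') ≤ 3 * δ := by
          intro k' hk'
          have h1 := hfe y
          rw [hyk] at h1
          have h2 := dist_triangle4 y (e k) (z (c k)) (e k')
          have h3 := hc k'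
          rw [hk', dist_comm] at h3
          linarith [hc k]
        refine Set.mem_biUnion (Finset.mem_coe.2 (Finset.mem_univ j)) ?_
        have := abs_angle_sub_arccos_le hlt₁.le hlt₂.le (hdist _ h₁) (hdist _ h₂)
        simp only [band, Set.mem_ofPred_eq]
        linarith
    _ ≤ ∑ j, (sphereMeasure d).real (band j) := measureReal_biUnion_finset_le _ _
    _ ≤ ∑ j : Fin (ℓ + 1), 6 * δ * Real.sqrt d := by
        refine Finset.sum_le_sum fun j _ => ?_
        exact ENNReal.toReal_le_of_le_ofReal (by positivity)
          (sphereMeasure_band_le d hd x (Real.arccos (s j)) (6 * δ))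
    _ = _ := by simp

/-! ### Rounding a discrete measure -/

/-- The sign-twisted spherical polynomials on a finite set of points, together with constants. -/
noncomputable def twistedPolynomials (d r : ℕ) {κ : Type*} (e : κ → UnitSphere d) (σ : κ → ℝ) :
    Submodule ℝ (κ → ℝ) :=
  Submodule.span ℝ {1} ⊔ (sphericalPolynomials d r).map
    ((LinearMap.mulLeft ℝ σ).comp (LinearMap.funLeft ℝ ℝ e))

theorem finrank_twistedPolynomials_le (d r : ℕ) {κ : Type*} [Fintype κ] (e : κ → UnitSphere d)
    (σ : κ → ℝ) : Module.finrank ℝ (twistedPolynomials d r e σ) ≤ sphericalDim d r + 1 := by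
  refine (Submodule.finrank_add_le_finrank_add_finrank _ _).trans ?_
  rw [add_comm]
  refine add_le_add (Submodule.finrank_map_le _ _) ?_
  exact (finrank_span_le_card ({1} : Set (κ → ℝ))).trans (by simp)

theorem one_mem_twistedPolynomials (d r : ℕ) {κ : Type*} (e : κ → UnitSphere d) (σ : κ → ℝ) :
    (1 : κ → ℝ) ∈ twistedPolynomials d r e σ :=
  Submodule.mem_sup_left (Submodule.mem_span_singleton_self _)

theorem polynomial_mem_twistedPolynomials (d r : ℕ) {κ : Type*} (e : κ → UnitSphere d) (σ : κ → ℝ)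
    {p : Polynomial ℝ} (hp : p.natDegree ≤ r) (x : UnitSphere d) :
    (fun k => σ k * p.eval (inner ℝ (x : EuclideanSpace ℝ (Fin (d + 1))) (e k))) ∈
      twistedPolynomials d r e σ :=
  Submodule.mem_sup_right
    ⟨_, Polynomial.eval_inner_mem_sphericalPolynomials d r p hp x, rfl⟩

section Cell

variable {d r ℓ : ℕ} {s : Fin (ℓ + 1) → ℝ} {Φ : ℝ → ℝ} {κ ι : Type*} [Fintype κ]
  {e : κ → UnitSphere d} {σ : κ → ℝ} {c : κ → ι} {i : ι} {a b : κ → ℝ}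

theorem sum_eq_of_not_cellCrossed (hΦ : IsPiecewisePolynomial r ℓ s Φ)
    (ha : ∀ k, c k ≠ i → a k = 0) (hb : b ∈ sparseRepresentatives (twistedPolynomials d r e σ) a)
    {x : UnitSphere d} (hx : ¬ CellCrossed s e c x i) :
    ∑ k, b k * (σ k * Φ (inner ℝ (x : EuclideanSpace ℝ (Fin (d + 1))) (e k))) =
      ∑ k, a k * (σ k * Φ (inner ℝ (x : EuclideanSpace ℝ (Fin (d + 1))) (e k))) := by
  obtain ⟨p, hp, hpe⟩ := hΦ.exists_eqOn_of_not_crossing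
    (T := (fun k => inner ℝ (x : EuclideanSpace ℝ (Fin (d + 1))) (e k)) '' {k | c k = i})
    (Set.toFinite _) (by
      rintro _ ⟨k, _, rfl⟩
      exact inner_mem_Icc x (e k)) (by
      rintro j _ ⟨k, hk, rfl⟩ _ ⟨k', hk', rfl⟩ hlt
      by_contra! h
      exact hx ⟨j, k, k', hk, hk', hlt, h⟩)
  have key : ∀ u : κ → ℝ, (∀ k, c k ≠ i → u k = 0) →
      ∑ k, u k * (σ k * Φ (inner ℝ (x : EuclideanSpace ℝ (Fin (d + 1))) (e k))) =
      ∑ k, u k * (σ k * p.eval (inner ℝ (x : EuclideanSpace ℝ (Fin (d + 1))) (e k))) := by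
    intro u hu
    refine Finset.sum_congr rfl fun k _ => ?_
    by_cases hk : c k = i
    · rw [hpe _ ⟨k, hk, rfl⟩]
    · rw [hu k hk, zero_mul, zero_mul]
  rw [key a ha, key b fun k hk => hb.2.1 k (ha k hk)]
  exact hb.2.2.2 _ (polynomial_mem_twistedPolynomials d r e σ hp x)

theorem sum_eq_of_mem_sparseRepresentatives
    (hb : b ∈ sparseRepresentatives (twistedPolynomials d r e σ) a) : ∑ k, b k = ∑ k, a k := by
  simpa using hb.2.2.2 1 (one_mem_twistedPolynomials d r e σ)

/-- Constants are polynomials of degree at most `r`, so `Φ` may be recentred at its value at `z`.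
What remains is at most `δ` in absolute value on the cell, against the equal masses of `a` and `b`.
-/
theorem abs_sum_sub_sum_le
    (hLip : ∀ t ∈ Set.Icc (-1 : ℝ) 1, ∀ t' ∈ Set.Icc (-1 : ℝ) 1, |Φ t - Φ t'| ≤ |t - t'|)
    (hσ : ∀ k, |σ k| = 1) (ha0 : ∀ k, 0 ≤ a k) (ha : ∀ k, c k ≠ i → a k = 0)
    (hb : b ∈ sparseRepresentatives (twistedPolynomials d r e σ) a) {δ : ℝ} {z : UnitSphere d}
    (hz : ∀ k, c k = i → dist (e k) z ≤ δ) (x : UnitSphere d) :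
    |∑ k, b k * (σ k * Φ (inner ℝ (x : EuclideanSpace ℝ (Fin (d + 1))) (e k))) -
      ∑ k, a k * (σ k * Φ (inner ℝ (x : EuclideanSpace ℝ (Fin (d + 1))) (e k)))| ≤
      2 * δ * ∑ k, a k := by
  have hconst := hb.2.2.2 _ (polynomial_mem_twistedPolynomials d r e σ (p := Polynomial.C
    (Φ (inner ℝ (x : EuclideanSpace ℝ (Fin (d + 1))) z))) (by simp) x)
  simp only [Polynomial.eval_C] at hconst
  have hsum : ∑ k, b k * (σ k * Φ (inner ℝ (x : EuclideanSpace ℝ (Fin (d + 1))) (e k))) -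
      ∑ k, a k * (σ k * Φ (inner ℝ (x : EuclideanSpace ℝ (Fin (d + 1))) (e k))) =
      ∑ k, (b k - a k) * (σ k * (Φ (inner ℝ (x : EuclideanSpace ℝ (Fin (d + 1))) (e k)) -
        Φ (inner ℝ (x : EuclideanSpace ℝ (Fin (d + 1))) z))) := by
    simp only [mul_sub, sub_mul, Finset.sum_sub_distrib, hconst]
    ring
  rw [hsum]
  calc _ ≤ ∑ k, (b k + a k) * δ := by
        refine (Finset.abs_sum_le_sum_abs _ _).trans (Finset.sum_le_sum fun k _ => ?_)
        by_cases hk : c k = i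
        · rw [abs_mul, abs_mul, hσ, one_mul]
          refine mul_le_mul ?_ ?_ (abs_nonneg _) (add_nonneg (hb.1 k) (ha0 k))
          · rw [abs_le]
            constructor <;> linarith [hb.1 k, ha0 k]
          · exact (hLip _ (inner_mem_Icc _ _) _ (inner_mem_Icc _ _)).trans
              ((abs_inner_sub_inner_le x (e k) z).trans (hz k hk))
        · rw [ha k hk, hb.2.1 k (ha k hk)]
          simp
    _ = 2 * δ * ∑ k, a k := by
        rw [← Finset.sum_mul, Finset.sum_add_distrib, sum_eq_of_mem_sparseRepresentatives hb]
        ring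

end Cell

open Classical in
-- The sampling argument: the simultaneous rounding bound is applied to the normalized errors of all
-- samples, evaluated at the net points `e m`.
theorem exists_rounding {d r ℓ : ℕ} {s : Fin (ℓ + 1) → ℝ} {Φ : ℝ → ℝ}
    (hΦ : IsPiecewisePolynomial r ℓ s Φ)
    (hLip : ∀ t ∈ Set.Icc (-1 : ℝ) 1, ∀ t' ∈ Set.Icc (-1 : ℝ) 1, |Φ t - Φ t'| ≤ |t - t'|)
    {n M N : ℕ} (e : Fin n → UnitSphere d) (w ν : Fin n → ℝ) (hν : ∀ k, |ν k| ≤ w k)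
    (hw : ∑ k, w k = 1) (c : Fin n → Fin M) (z : Fin M → UnitSphere d) {δ : ℝ} (hδ : 0 < δ)
    (hz : ∀ k, dist (e k) (z (c k)) ≤ δ) (hN : 0 < N) (hM : (M : ℝ) ≤ N / 2)
    {B : ℝ} (hB : 0 < B)
    (hcross : ∀ x, ∑ k, (if CellCrossed s e c x (c k) then w k else 0) ≤ B)
    {K : ℝ} (hK : 0 < K) (hnK : 2 * (n : ℝ) ≤ Real.exp K) :
    ∃ C : Fin n → ℝ, (Function.support C).ncard ≤ N * (sphericalDim d r + 1) ∧ ∑ k, |C k| ≤ 1 ∧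
      ∀ m : Fin n,
        |∑ k, ν k * Φ (inner ℝ (e m : EuclideanSpace ℝ (Fin (d + 1))) (e k)) -
          ∑ k, C k * Φ (inner ℝ (e m : EuclideanSpace ℝ (Fin (d + 1))) (e k))| ≤
          Real.sqrt (2 * (8 * δ ^ 2 / N * B) * K) := by
  have hN' : (0 : ℝ) < N := by exact_mod_cast hN
  have hw0 : ∀ k, 0 ≤ w k := fun k => (abs_nonneg _).trans (hν k)
  let σ : Fin n → ℝ := fun k => if ν k < 0 then -1 else 1
  have hσ : ∀ k, |σ k| = 1 := fun k => by
    simp only [σ]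
    split_ifs <;> simp
  have hσν : ∀ k, |ν k| * σ k = ν k := fun k => by
    simp only [σ]
    split_ifs with h
    · rw [abs_of_neg h]
      ring
    · rw [abs_of_nonneg (not_lt.1 h), mul_one]
  let W := twistedPolynomials d r e σ
  let a : Fin M → Fin n → ℝ := fun i k => if c k = i then |ν k| else 0
  have ha0 : ∀ i k, 0 ≤ a i k := fun i k => by
    simp only [a]
    split_ifs <;> simp
  have ha : ∀ i k, c k ≠ i → a i k = 0 := fun i k h => if_neg h
  let ω : Fin M → ℝ := fun i => ∑ k, if c k = i then w k else 0
  have hω0 : ∀ i, 0 ≤ ω i := fun i => Finset.sum_nonneg fun k _ => by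
    split_ifs
    · exact hw0 k
    · exact le_rfl
  have haω : ∀ i, ∑ k, a i k ≤ ω i := fun i => Finset.sum_le_sum fun k _ => by
    simp only [a]
    split_ifs
    · exact hν k
    · exact le_rfl
  have hω1 : ∑ i, ω i = 1 := by
    rw [← hw, Finset.sum_comm]
    simp
  -- Number of samples in cell `i`. Rounding up costs at most one per cell, so the total is at most
  -- `N / 2 + M ≤ N`, while rounding up ensures `ω² / τ ≤ 2ω / N`.
  let τ : Fin M → ℕ := fun i => ⌈ω i * N / 2⌉₊
  have hτ : ∀ i, ω i * N / 2 ≤ τ i := fun i => Nat.le_ceil _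
  have hτ' : ∀ i, (τ i : ℝ) ≤ ω i * N / 2 + 1 := fun i =>
    (Nat.ceil_lt_add_one (by have := hω0 i; positivity)).le
  -- A cell without samples carries no mass, so the default `0⁻¹ = 0` loses nothing.
  have hτa : ∀ i, τ i = 0 → ∀ k, a i k = 0 := fun i hi k => by
    have h1 := hτ i
    rw [hi, Nat.cast_zero] at h1
    have h2 : ω i ≤ 0 := by
      by_contra! h
      have : 0 < ω i * N / 2 := by positivity
      linarith
    exact (Finset.sum_eq_zero_iff_of_nonneg fun k _ => ha0 i k).1
      (le_antisymm ((haω i).trans h2) (Finset.sum_nonneg fun k _ => ha0 i k)) k (Finset.mem_univ k)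
  have hωτ : ∀ i, ω i ^ 2 / τ i ≤ 2 / N * ω i := fun i => by
    rcases Nat.eq_zero_or_pos (τ i) with h | h
    · rw [h, Nat.cast_zero, div_zero]
      have := hω0 i
      positivity
    · have h' : (0 : ℝ) < τ i := by exact_mod_cast h
      rw [div_le_iff₀ h']
      calc ω i ^ 2 = 2 / N * ω i * (ω i * N / 2) := by field_simp
        _ ≤ 2 / N * ω i * τ i := by
          have := hω0 i
          gcongr
          exact hτ i
  let φ : Fin n → Fin n → ℝ := fun m k => Φ (inner ℝ (e m : EuclideanSpace ℝ (Fin (d + 1))) (e k))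
  let L : Fin M → (Fin n → ℝ) →ₗ[ℝ] (Fin n → ℝ) := fun i =>
    (τ i : ℝ)⁻¹ • LinearMap.pi fun m => ∑ k, (σ k * φ m k) • LinearMap.proj k
  have hL : ∀ i b m, L i b m = (τ i : ℝ)⁻¹ * ∑ k, b k * (σ k * φ m k) := fun i b m => by
    simp [L, mul_comm]
  let A : Fin M → (Fin n → ℝ) →ᵃ[ℝ] (Fin n → ℝ) := fun i =>
    (L i).toAffineMap - AffineMap.const ℝ _ (L i (a i))
  have hA : ∀ i b m, A i b m =
      (τ i : ℝ)⁻¹ * (∑ k, b k * (σ k * φ m k) - ∑ k, a i k * (σ k * φ m k)) := fun i b m => by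
    simp [A, hL, mul_sub]
  let R : Fin M → Set (Fin n → ℝ) := fun i => sparseRepresentatives W (a i)
  let P := (i : Fin M) × Fin (τ i)
  let cst : P → Fin n → ℝ := fun p m =>
    if CellCrossed s e c (e m) p.1 then (τ p.1 : ℝ)⁻¹ * (2 * δ * ω p.1) else 0
  obtain ⟨v, hv, hvle⟩ := exists_choice_abs_sum_le (Finset.univ : Finset P)
    -- `A i` sends `a i` to `0`; an affine map commutes with convex hulls, so the errors average to
    -- zero.
    (fun p => A p.1 '' R p.1) cst (fun p _ => by
      rw [← AffineMap.image_convexHull]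
      refine ⟨a p.1, mem_convexHull_sparseRepresentatives W
        (one_mem_twistedPolynomials d r e σ) _ (ha0 p.1), ?_⟩
      ext m
      rw [hA]
      simp)
    (by
      rintro p _ _ ⟨b, hb, rfl⟩ m
      rw [hA]
      simp only [cst]
      split_ifs with hcr
      · rw [abs_mul, abs_of_nonneg (inv_nonneg.2 (Nat.cast_nonneg _))]
        refine mul_le_mul_of_nonneg_left ?_ (inv_nonneg.2 (Nat.cast_nonneg _))
        refine (abs_sum_sub_sum_le hLip hσ (ha0 p.1) (ha p.1) hb
          (fun k hk => hk ▸ hz k) (e m)).trans ?_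
        exact mul_le_mul_of_nonneg_left (haω p.1) (by positivity)
      · rw [sum_eq_of_not_cellCrossed hΦ (ha p.1) hb hcr]
        simp [φ])
    (V := 8 * δ ^ 2 / N * B) (K := K) (by positivity) (by
      intro m
      have hfib : ∀ i, ∑ j : Fin (τ i), cst ⟨i, j⟩ m ^ 2 ≤
          8 * δ ^ 2 / N * (if CellCrossed s e c (e m) i then ω i else 0) := by
        intro i
        simp only [cst, Finset.sum_const, Finset.card_univ, Fintype.card_fin, nsmul_eq_mul]
        split_ifs with hcr
        · calc _ = 4 * δ ^ 2 * (ω i ^ 2 / τ i) := by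
                rcases Nat.eq_zero_or_pos (τ i) with h | h
                · simp [h]
                · have h' : (0 : ℝ) < τ i := by exact_mod_cast h
                  field_simp
                  ring
            _ ≤ 4 * δ ^ 2 * (2 / N * ω i) := by
                gcongr
                exact hωτ i
            _ = _ := by ring
        · simp
      rw [Fintype.sum_sigma]
      refine (Finset.sum_le_sum fun i _ => hfib i).trans ?_
      rw [← Finset.mul_sum]
      refine mul_le_mul_of_nonneg_left (le_trans (le_of_eq ?_) (hcross (e m))) (by positivity)
      calc _ = ∑ i, ∑ k, (if c k = i then (if CellCrossed s e c (e m) (c k) then w k else 0)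
            else 0) := by
            refine Finset.sum_congr rfl fun i _ => ?_
            split_ifs with hcr
            · refine Finset.sum_congr rfl fun k _ => ?_
              by_cases hk : c k = i
              · simp [hk, hcr]
              · simp [hk]
            · refine (Finset.sum_eq_zero fun k _ => ?_).symm
              by_cases hk : c k = i
              · simp [hk, hcr]
              · simp [hk]
        _ = _ := by
            rw [Finset.sum_comm]
            simp)
    hK (by simpa using hnK)
  choose b hb hbv using fun p : P => hv p (Finset.mem_univ p)
  refine ⟨fun k => σ k * ∑ p : P, (τ p.1 : ℝ)⁻¹ * b p k, ?_, ?_, fun m => ?_⟩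
  · have hsupp : Function.support (fun k => σ k * ∑ p : P, (τ p.1 : ℝ)⁻¹ * b p k) ⊆
        ⋃ p ∈ (Finset.univ : Finset P), Function.support (b p) := by
      intro k hk
      by_contra hnot
      simp only [Finset.mem_univ, Set.iUnion_true, Set.mem_iUnion, Function.mem_support,
        not_exists, not_not] at hnot
      exact hk (by simp [hnot])
    refine (Set.ncard_le_ncard hsupp (Set.toFinite _)).trans
      ((Finset.set_ncard_biUnion_le _ _).trans ?_)
    refine (Finset.sum_le_card_nsmul _ _ (sphericalDim d r + 1) fun p _ =>
      (hb p).2.2.1.trans (finrank_twistedPolynomials_le d r e σ)).trans ?_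
    rw [smul_eq_mul]
    refine Nat.mul_le_mul_right _ ?_
    have hcard : ((Finset.univ : Finset P).card : ℝ) ≤ N := by
      simp only [P, Finset.card_univ, Fintype.card_sigma, Fintype.card_fin, Nat.cast_sum]
      calc _ ≤ ∑ i, (ω i * N / 2 + 1) := Finset.sum_le_sum fun i _ => hτ' i
        _ = (∑ i, ω i) * N / 2 + M := by
          rw [Finset.sum_add_distrib, ← Finset.sum_div, ← Finset.sum_mul]
          simp
        _ ≤ N := by
          rw [hω1]
          linarith
    exact_mod_cast hcard
  · calc _ ≤ ∑ k, ∑ p : P, (τ p.1 : ℝ)⁻¹ * b p k := by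
          refine Finset.sum_le_sum fun k _ => ?_
          rw [abs_mul, hσ, one_mul, abs_of_nonneg]
          exact Finset.sum_nonneg fun p _ =>
            mul_nonneg (inv_nonneg.2 (Nat.cast_nonneg _)) ((hb p).1 k)
      _ = ∑ p : P, (τ p.1 : ℝ)⁻¹ * ∑ k, a p.1 k := by
          rw [Finset.sum_comm]
          refine Finset.sum_congr rfl fun p _ => ?_
          rw [← Finset.mul_sum, sum_eq_of_mem_sparseRepresentatives (hb p)]
      _ ≤ ∑ i, ω i := by
          rw [Fintype.sum_sigma]
          refine Finset.sum_le_sum fun i _ => ?_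
          simp only [Finset.sum_const, Finset.card_univ, Fintype.card_fin, nsmul_eq_mul]
          rcases Nat.eq_zero_or_pos (τ i) with h | h
          · simpa [h] using hω0 i
          · have h' : (τ i : ℝ) ≠ 0 := by exact_mod_cast h.ne'
            rw [mul_inv_cancel_left₀ h']
            exact haω i
      _ = 1 := hω1
  · have hmain : ∑ p : P, v p m = ∑ k, (σ k * ∑ p : P, (τ p.1 : ℝ)⁻¹ * b p k) * φ m k -
        ∑ k, ν k * φ m k := by
      have h1 : ∀ p : P, v p m = (τ p.1 : ℝ)⁻¹ * ∑ k, b p k * (σ k * φ m k) -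
          (τ p.1 : ℝ)⁻¹ * ∑ k, a p.1 k * (σ k * φ m k) := fun p => by
        rw [← hbv p, hA, mul_sub]
      rw [Finset.sum_congr rfl fun p _ => h1 p, Finset.sum_sub_distrib]
      congr 1
      · simp only [Finset.mul_sum, Finset.sum_mul]
        rw [Finset.sum_comm]
        refine Finset.sum_congr rfl fun k _ => Finset.sum_congr rfl fun p _ => ?_
        ring
      · rw [Fintype.sum_sigma]
        calc _ = ∑ i, ∑ k, a i k * (σ k * φ m k) := by
              refine Finset.sum_congr rfl fun i _ => ?_
              simp only [Finset.sum_const, Finset.card_univ, Fintype.card_fin, nsmul_eq_mul]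
              rcases Nat.eq_zero_or_pos (τ i) with h | h
              · simp [h, hτa i h]
              · have h' : (τ i : ℝ) ≠ 0 := by exact_mod_cast h.ne'
                rw [mul_inv_cancel_left₀ h']
          _ = _ := by
              rw [Finset.sum_comm]
              refine Finset.sum_congr rfl fun k _ => ?_
              rw [← Finset.sum_mul, ← mul_assoc]
              congr 1
              simp only [a, Finset.sum_ite_eq, Finset.mem_univ, if_true, hσν]
    have := hvle m
    rw [hmain, abs_sub_comm] at this
    exact this

/-! ### Approximation of the integral operator -/

/-- Enumerate the support and pad the unused slots with weight zero. -/
theorem exists_fin_sum_eq {κ S : Type*} [Fintype κ] [Nonempty S] (y : κ → S) (C : κ → ℝ) {n : ℕ}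
    (hn : (Function.support C).ncard ≤ n) :
    ∃ (ξ : Fin n → S) (lam : Fin n → ℝ), ∀ F : S → ℝ, ∑ j, lam j * F (ξ j) = ∑ k, C k * F (y k) := by
  classical
  let T : Finset κ := Finset.univ.filter fun k => C k ≠ 0
  have hT : T.card ≤ n := by
    rw [← Set.ncard_coe_finset]
    convert hn using 2
    ext k
    simp [T]
  obtain ⟨y₀⟩ := ‹Nonempty S›
  let E := T.equivFin
  refine ⟨fun j => if h : (j : ℕ) < T.card then y (E.symm ⟨j, h⟩) else y₀,
    fun j => if h : (j : ℕ) < T.card then C (E.symm ⟨j, h⟩) else 0, fun F => ?_⟩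
  have h1 : ∑ k, C k * F (y k) = ∑ k : T, C k * F (y k) := by
    rw [Finset.sum_coe_sort T fun k => C k * F (y k)]
    refine (Finset.sum_subset (Finset.subset_univ T) fun k _ hk => ?_).symm
    have : C k = 0 := by simpa [T] using hk
    rw [this, zero_mul]
  rw [h1, ← E.symm.sum_comp]
  refine (Finset.sum_of_injOn (Fin.castLE hT) (Fin.castLE_injective hT).injOn
    (fun _ _ => by simp) (fun j _ hj => ?_) fun j _ => ?_).symm
  · have : ¬ (j : ℕ) < T.card := fun h => hj ⟨⟨j, h⟩, by simp, by ext; simp⟩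
    simp [this]
  · simp

theorem exists_sparse_approximation (d : ℕ) (hd : 1 ≤ d) {r ℓ : ℕ} {s : Fin (ℓ + 1) → ℝ}
    {Φ : ℝ → ℝ} (hΦ : IsPiecewisePolynomial r ℓ s Φ)
    (hLip : ∀ t ∈ Set.Icc (-1 : ℝ) 1, ∀ t' ∈ Set.Icc (-1 : ℝ) 1, |Φ t - Φ t'| ≤ |t - t'|)
    {g : UnitSphere d → ℝ} (hg : MemLp g ⊤ (sphereMeasure d))
    (hg1 : eLpNorm g ⊤ (sphereMeasure d) ≤ 1) {M N n : ℕ} {ε δ K : ℝ} (hε : 0 < ε) (hεδ : ε ≤ δ)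
    (hN : 0 < N) (e : Fin n → UnitSphere d) (he : ∀ y, ∃ k, dist y (e k) ≤ ε)
    (z : Fin M → UnitSphere d) (hz : ∀ y, ∃ i, dist y (z i) ≤ δ) (hM : (M : ℝ) ≤ N / 2)
    (hK : 0 < K) (hnK : 2 * (n : ℝ) ≤ Real.exp K) :
    ∃ C : Fin n → ℝ, (Function.support C).ncard ≤ N * (sphericalDim d r + 1) ∧
      ∀ x : UnitSphere d,
        |(∫ y : UnitSphere d, Φ (inner ℝ (x : EuclideanSpace ℝ (Fin (d + 1))) y) * g y
              ∂(sphereMeasure d)) -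
            ∑ k, C k * Φ (inner ℝ (x : EuclideanSpace ℝ (Fin (d + 1))) (e k))| ≤
          Real.sqrt (2 * (8 * δ ^ 2 / N * ((ℓ + 1) * (6 * δ * Real.sqrt d))) * K) + 3 * ε := by
  have hδ : 0 < δ := hε.trans_le hεδ
  have hd0 : (0 : ℝ) < d := by exact_mod_cast hd
  have hgae : ∀ᵐ y ∂(sphereMeasure d), |g y| ≤ 1 := by
    rw [eLpNorm_exponent_top] at hg1
    filter_upwards [ae_le_eLpNormEssSup (f := g) (μ := sphereMeasure d)] with y hy
    have := hy.trans hg1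
    rw [← ofReal_norm, ENNReal.ofReal_le_one] at this
    exact this
  have hgint : Integrable g (sphereMeasure d) := memLp_one_iff_integrable.1 (hg.mono_exponent le_top)
  have hΦy : ∀ x y y' : UnitSphere d,
      |Φ (inner ℝ (x : EuclideanSpace ℝ (Fin (d + 1))) y) -
        Φ (inner ℝ (x : EuclideanSpace ℝ (Fin (d + 1))) y')| ≤ dist y y' := fun x y y' =>
    (hLip _ (inner_mem_Icc _ _) _ (inner_mem_Icc _ _)).trans (abs_inner_sub_inner_le x y y')
  have hcont : ∀ x : UnitSphere d, Continuous fun y : UnitSphere d =>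
      Φ (inner ℝ (x : EuclideanSpace ℝ (Fin (d + 1))) y) := fun x =>
    (LipschitzWith.of_dist_le_mul (K := 1) fun y y' => by
      simpa [Real.dist_eq] using hΦy x y y').continuous
  obtain ⟨f, hf, hfe⟩ := exists_measurable_nearby_index e he
  choose c hc using fun k => hz (e k)
  let ν : Fin n → ℝ := fun k => ∫ y in f ⁻¹' {k}, g y ∂(sphereMeasure d)
  let w : Fin n → ℝ := fun k => (sphereMeasure d).real (f ⁻¹' {k})
  have hν : ∀ k, |ν k| ≤ w k := fun k => abs_setIntegral_le_measureReal hgae _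
  have hw : ∑ k, w k = 1 := by
    have := integral_eq_sum_setIntegral_preimage hf (integrable_const (1 : ℝ) (μ := sphereMeasure d))
    simpa [w] using this.symm
  obtain ⟨C, hCs, hC1, hC⟩ := exists_rounding hΦ hLip e w ν hν hw c z hδ hc hN hM
    (B := (ℓ + 1) * (6 * δ * Real.sqrt d)) (by have := Real.sqrt_pos.2 hd0; positivity)
    (fun x => sum_cellCrossed_le hd s hf hfe hεδ hc x) hK hnK
  refine ⟨C, hCs, fun x => ?_⟩
  have hdisc := abs_integral_sub_sum_le hf hgint (F := fun y =>
    Φ (inner ℝ (x : EuclideanSpace ℝ (Fin (d + 1))) y))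
    (c := fun k => Φ (inner ℝ (x : EuclideanSpace ℝ (Fin (d + 1))) (e k))) (ε := ε)
    (by
      obtain ⟨b, hb⟩ := isCompact_univ.exists_bound_of_continuousOn (hcont x).continuousOn
      exact hgint.bdd_mul (c := b) (hcont x).aestronglyMeasurable
        (Filter.Eventually.of_forall fun y => hb y trivial))
    hgae (fun y => (hΦy x _ _).trans (hfe y))
  obtain ⟨m, hm⟩ := he x
  -- Used for both `ν` and `C`; with the discretization error this accounts for `3 * ε`.
  have hmove : ∀ u : Fin n → ℝ, ∑ k, |u k| ≤ 1 →
      |∑ k, u k * Φ (inner ℝ (x : EuclideanSpace ℝ (Fin (d + 1))) (e k)) -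
        ∑ k, u k * Φ (inner ℝ (e m : EuclideanSpace ℝ (Fin (d + 1))) (e k))| ≤ ε := by
    intro u hu
    rw [← Finset.sum_sub_distrib]
    calc _ ≤ ∑ k, |u k| * ε := by
          refine (Finset.abs_sum_le_sum_abs _ _).trans (Finset.sum_le_sum fun k _ => ?_)
          rw [← mul_sub, abs_mul, real_inner_comm (e k : EuclideanSpace ℝ (Fin (d + 1))),
            real_inner_comm (e k : EuclideanSpace ℝ (Fin (d + 1)))]
          exact mul_le_mul_of_nonneg_left ((hΦy _ _ _).trans hm) (abs_nonneg _)
      _ ≤ ε := by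
          rw [← Finset.sum_mul]
          exact mul_le_of_le_one_left hε.le hu
  have h1 := hmove ν ((Finset.sum_le_sum fun k _ => hν k).trans hw.le)
  have h2 := hmove C hC1
  have h3 := hC m
  have h4 : |∫ y, Φ (inner ℝ (x : EuclideanSpace ℝ (Fin (d + 1))) y) * g y ∂(sphereMeasure d) -
      ∑ k, ν k * Φ (inner ℝ (x : EuclideanSpace ℝ (Fin (d + 1))) (e k))| ≤ ε := hdisc
  rw [abs_le] at h1 h2 h3 h4 ⊢
  constructor <;> linarith [h1.1, h1.2, h2.1, h2.2, h3.1, h3.2, h4.1, h4.2]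

theorem two_mul_card_le_exp {d N n : ℕ} (hd : 1 ≤ d) (hN : 20 ≤ N)
    (hn : n = 1 ∨ (n : ℝ) ≤ (16 / ((N : ℝ) ^ 2)⁻¹) ^ d) :
    2 * (n : ℝ) ≤ Real.exp (4 * d * Real.log N) := by
  have hN' : (20 : ℝ) ≤ N := by exact_mod_cast hN
  have hexp : Real.exp (4 * d * Real.log N) = ((N : ℝ) ^ 4) ^ d := by
    rw [← pow_mul, ← Real.exp_log (show (0 : ℝ) < N by linarith), ← Real.exp_nat_mul,
      Real.log_exp]
    push_cast
    ring_nf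
  have hn' : (n : ℝ) ≤ (16 * (N : ℝ) ^ 2) ^ d := by
    rcases hn with rfl | hn
    · rw [Nat.cast_one]
      exact one_le_pow₀ (by nlinarith)
    · rwa [div_inv_eq_mul] at hn
  rw [hexp]
  calc 2 * (n : ℝ) ≤ 2 ^ d * (16 * (N : ℝ) ^ 2) ^ d := by
        gcongr
        exact le_self_pow₀ one_le_two (by omega)
    _ = (32 * (N : ℝ) ^ 2) ^ d := by rw [← mul_pow]; ring_nf
    _ ≤ ((N : ℝ) ^ 4) ^ d := by
        refine pow_le_pow_left₀ (by positivity) ?_ d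
        calc 32 * (N : ℝ) ^ 2 ≤ (N : ℝ) ^ 2 * (N : ℝ) ^ 2 := by
              gcongr
              nlinarith
          _ = _ := by ring

theorem card_le_half {d N M : ℕ} (hd : 1 ≤ d) (hN : 20 ≤ N)
    (hM : M = 1 ∨ (M : ℝ) ≤ (16 / (32 * (N : ℝ) ^ (-(1 / (d : ℝ))))) ^ d) :
    (M : ℝ) ≤ N / 2 := by
  have hN' : (20 : ℝ) ≤ N := by exact_mod_cast hN
  have hd0 : (d : ℝ) ≠ 0 := by exact_mod_cast (by omega : d ≠ 0)
  rcases hM with rfl | hM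
  · rw [Nat.cast_one]
    linarith
  · refine hM.trans ?_
    have h1 : 16 / (32 * (N : ℝ) ^ (-(1 / (d : ℝ)))) = (N : ℝ) ^ (1 / (d : ℝ)) / 2 := by
      rw [Real.rpow_neg (by linarith)]
      have : (0 : ℝ) < (N : ℝ) ^ (1 / (d : ℝ)) := by positivity
      field_simp
      norm_num
    rw [h1, div_pow, ← Real.rpow_natCast ((N : ℝ) ^ (1 / (d : ℝ))), ← Real.rpow_mul (by linarith),
      one_div_mul_cancel hd0, Real.rpow_one]
    gcongr
    exact le_self_pow₀ one_le_two (by omega)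

theorem error_bound_le {d ℓ N : ℕ} (hd : 1 ≤ d) (hℓ : 1 ≤ ℓ) (hN : 20 ≤ N) :
    Real.sqrt (2 * (8 * (32 * (N : ℝ) ^ (-(1 / (d : ℝ)))) ^ 2 / N *
      ((ℓ + 1) * (6 * (32 * (N : ℝ) ^ (-(1 / (d : ℝ)))) * Real.sqrt d))) *
      (4 * d * Real.log N)) + 3 * ((N : ℝ) ^ 2)⁻¹ ≤
    7 * 10 ^ 6 * Real.sqrt ℓ * (d : ℝ) ^ (3 / 4 : ℝ) *
      (N : ℝ) ^ (-(1 / 2 : ℝ) - 3 / (2 * (d : ℝ))) * Real.sqrt (Real.log N) := by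
  have hN' : (20 : ℝ) ≤ N := by exact_mod_cast hN
  have hN0 : (0 : ℝ) < N := by linarith
  have hd' : (1 : ℝ) ≤ d := by exact_mod_cast hd
  have hd0 : (0 : ℝ) < d := by linarith
  have hℓ' : (1 : ℝ) ≤ ℓ := by exact_mod_cast hℓ
  have hlog : 1 ≤ Real.log N := by
    rw [Real.le_log_iff_exp_le hN0]
    linarith [Real.exp_one_lt_d9]
  set G : ℝ := Real.sqrt ℓ * (d : ℝ) ^ (3 / 4 : ℝ) *
      (N : ℝ) ^ (-(1 / 2 : ℝ) - 3 / (2 * (d : ℝ))) * Real.sqrt (Real.log N) with hG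
  have hG0 : 0 ≤ G := by positivity
  have hGsq : G ^ 2 = ℓ * (d * Real.sqrt d) * ((N : ℝ)⁻¹ * ((N : ℝ) ^ (-(1 / (d : ℝ)))) ^ 3) *
      Real.log N := by
    rw [hG, mul_pow, mul_pow, mul_pow, Real.sq_sqrt (by linarith), Real.sq_sqrt (by linarith)]
    congr 2
    · rw [Real.sqrt_eq_rpow, ← Real.rpow_natCast, ← Real.rpow_mul hd0.le]
      nth_rw 2 [← Real.rpow_one (d : ℝ)]
      rw [← Real.rpow_add hd0]
      norm_num
    · rw [← Real.rpow_natCast, ← Real.rpow_natCast, ← Real.rpow_mul hN0.le, ← Real.rpow_mul hN0.le,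
        ← Real.rpow_neg_one, ← Real.rpow_add hN0]
      congr 1
      push_cast
      field_simp
      ring
  have hroot : Real.sqrt (2 * (8 * (32 * (N : ℝ) ^ (-(1 / (d : ℝ)))) ^ 2 / N *
      ((ℓ + 1) * (6 * (32 * (N : ℝ) ^ (-(1 / (d : ℝ)))) * Real.sqrt d))) *
      (4 * d * Real.log N)) ≤ 6000 * G := by
    refine Real.sqrt_le_iff.2 ⟨by positivity, ?_⟩
    set X : ℝ := d * Real.sqrt d * ((N : ℝ)⁻¹ * ((N : ℝ) ^ (-(1 / (d : ℝ)))) ^ 3) * Real.log N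
    have hX : 0 ≤ X := by positivity
    -- The constant is `2 · 8 · 32² · 6 · 32 · 4`; after `ℓ + 1 ≤ 2ℓ` it stays below `6000²`.
    calc _ = 12582912 * (ℓ + 1) * X := by
          simp only [X]
          field_simp
          ring
      _ ≤ 12582912 * (ℓ + ℓ) * X := by gcongr
      _ ≤ 36000000 * (ℓ * X) := by
          have : 0 ≤ (ℓ : ℝ) * X := by positivity
          linarith
      _ = (6000 * G) ^ 2 := by
          rw [mul_pow, hGsq]
          simp only [X]
          ring
  have hsmall : ((N : ℝ) ^ 2)⁻¹ ≤ G := by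
    have h1 : ((N : ℝ) ^ 2)⁻¹ ≤ (N : ℝ) ^ (-(1 / 2 : ℝ) - 3 / (2 * (d : ℝ))) := by
      rw [← Real.rpow_natCast, ← Real.rpow_neg hN0.le]
      refine Real.rpow_le_rpow_of_exponent_le (by linarith) ?_
      have : 3 / (2 * (d : ℝ)) ≤ 3 / 2 := by
        gcongr
        linarith
      push_cast
      linarith
    have h2 : 1 ≤ Real.sqrt ℓ := Real.one_le_sqrt.2 hℓ'
    have h3 : 1 ≤ (d : ℝ) ^ (3 / 4 : ℝ) := Real.one_le_rpow hd' (by norm_num)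
    have h4 : 1 ≤ Real.sqrt (Real.log N) := Real.one_le_sqrt.2 hlog
    calc _ ≤ _ := h1
      _ = 1 * 1 * (N : ℝ) ^ (-(1 / 2 : ℝ) - 3 / (2 * (d : ℝ))) * 1 := by ring
      _ ≤ G := by
        rw [hG]
        gcongr
  calc _ ≤ 6000 * G + 3 * G := by gcongr
    _ ≤ 7 * 10 ^ 6 * G := by linarith
    _ = _ := by rw [hG]; ring

theorem mainTheorem1 (d : ℕ) (hd : 1 ≤ d) (r ℓ : ℕ) (s : Fin (ℓ + 1) → ℝ) (Φ : ℝ → ℝ)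
    (hΦ : IsPiecewisePolynomial r ℓ s Φ)
    (hLip : ∀ t ∈ Set.Icc (-1 : ℝ) 1, ∀ t' ∈ Set.Icc (-1 : ℝ) 1, |Φ t - Φ t'| ≤ |t - t'|)
    (g : UnitSphere d → ℝ) (hg : MemLp g ⊤ (sphereMeasure d))
    (hg1 : eLpNorm g ⊤ (sphereMeasure d) ≤ 1)
    (N : ℕ) (hN : 20 ≤ N) :
    ∃ (ξ : Fin (2 * (sphericalDim d r + 2) * N) → UnitSphere d)
      (lam : Fin (2 * (sphericalDim d r + 2) * N) → ℝ),
      ∀ x : UnitSphere d,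
        |(∫ y : UnitSphere d, Φ (inner ℝ (x : EuclideanSpace ℝ (Fin (d + 1))) y) * g y
              ∂(sphereMeasure d)) -
            ∑ j, lam j * Φ (inner ℝ (x : EuclideanSpace ℝ (Fin (d + 1))) (ξ j))| ≤
          7 * 10 ^ 6 * Real.sqrt ℓ * (d : ℝ) ^ (3 / 4 : ℝ) *
            (N : ℝ) ^ (-(1 / 2 : ℝ) - 3 / (2 * (d : ℝ))) * Real.sqrt (Real.log N) := by
  have hN' : (20 : ℝ) ≤ N := by exact_mod_cast hN
  have hN0 : (0 : ℝ) < N := by linarith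
  have hd' : (1 : ℝ) ≤ d := by exact_mod_cast hd
  -- Coarse scale: `16 / 32 = 1 / 2` in the covering bound leaves at most `N / 2^d ≤ N / 2` cells.
  -- The fine scale `N⁻²` is within the target rate for every `d ≥ 1`, since `1/2 + 3/(2d) ≤ 2`.
  have hτ : 0 < 32 * (N : ℝ) ^ (-(1 / (d : ℝ))) := by positivity
  obtain ⟨n, e, he, hn⟩ := exists_sphere_cover d hd (δ := ((N : ℝ) ^ 2)⁻¹) (by positivity)
  obtain ⟨M, z, hz, hM⟩ := exists_sphere_cover d hd hτ
  have hεδ : ((N : ℝ) ^ 2)⁻¹ ≤ 32 * (N : ℝ) ^ (-(1 / (d : ℝ))) := by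
    have h1 : ((N : ℝ) ^ 2)⁻¹ ≤ (N : ℝ) ^ (-(1 / (d : ℝ))) := by
      rw [← Real.rpow_natCast, ← Real.rpow_neg hN0.le]
      refine Real.rpow_le_rpow_of_exponent_le (by linarith) ?_
      have : 1 / (d : ℝ) ≤ 1 := (div_le_one (by linarith)).2 hd'
      push_cast
      linarith
    linarith
  have hlog : 0 < Real.log N := Real.log_pos (by linarith)
  obtain ⟨C, hCs, hC⟩ := exists_sparse_approximation d hd hΦ hLip hg hg1 (N := N)
    (K := 4 * d * Real.log N) (by positivity) hεδ (by omega) e he z hz (card_le_half hd hN hM)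
    (by positivity) (two_mul_card_le_exp hd hN hn)
  have : Nonempty (UnitSphere d) := ⟨⟨EuclideanSpace.single 0 1, by simp⟩⟩
  obtain ⟨ξ, lam, hξ⟩ := exists_fin_sum_eq e C (n := 2 * (sphericalDim d r + 2) * N)
    (hCs.trans (by
      rw [mul_comm]
      exact Nat.mul_le_mul_right N (by omega)))
  refine ⟨ξ, lam, fun x => ?_⟩
  rw [hξ fun y => Φ (inner ℝ (x : EuclideanSpace ℝ (Fin (d + 1))) y)]
  exact (hC x).trans (error_bound_le hd hΦ.pos hN)
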